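/- **Conventions.** For a set $X$ of ordinals and a cardinal $c$, $[X]^c=\{Y\subseteq X: |Y|=c\}$, and a cardinal is identified with its initial ordinal (so $[\mu]^n$ is the set of $n$-element sets of ordinals below $\mu$). For a set $a$ of ordinals, $\mathrm{otp}(a)$ is its order type; for $i<\mathrm{otp}(a)$, $a(i)$ is the unique $\alpha\in a$ with $\mathrm{otp}(a\cap\alpha)=i$; and $a[I]=\{a(i): i\in I\}$ for $I\subseteq\mathrm{otp}(a)$. * Sets of ordinals $a,b$ are *aligned* if $\mathrm{otp}(a)=\mathrm{otp}(b)$ and $\mathrm{otp}(a\cap\gamma)=\mathrm{otp}(b\cap\gamma)$ for all $\gamma\in a\cap b$. Put $\mathbf r(a,b)=\{i<\mathrm{otp}(a): a(i)\in b\}$ and $\mathrm{tp}_{\mathrm{int}}(a,b)=\{(i,j)\in\mathrm{otp}(a)\times\mathrm{otp}(b): a(i)=b(j)\}$. * Let $H$ be a set of ordinals, and let $u_b$ be a set of ordinals for each $b\in[H]^n$. The family $\langle u_b: b\in[H]^n\rangle$ is a *uniform $n$-dimensional $\Delta$-system* if there are an ordinal $\rho$ and sets $\mathbf r_{\mathbf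 m}\subseteq\rho$ for $\mathbf m\subseteq n=\{0,\dots,n-1\}$ such that (i) $\mathrm{otp}(u_b)=\rho$ for all $b\in[H]^n$; (ii) for all $a,b\in[H]^n$ and $\mathbf m\subseteq n$, if $a,b$ are aligned and $\mathbf r(a,b)=\mathbf m$, then $u_a,u_b$ are aligned and $\mathbf r(u_a,u_b)=\mathbf r_{\mathbf m}$; (iii) $\mathbf r_{\mathbf m_0\cap\mathbf m_1}=\mathbf r_{\mathbf m_0}\cap\mathbf r_{\mathbf m_1}$ for all $\mathbf m_0,\mathbf m_1\subseteq n$. * Let $a,b$ be $n$-element sets of ordinals and $m<n$. They are *aligned above $m$* if $a[n\setminus m]$ and $b[n\setminus m]$ are aligned, where $n\setminus m=\{m,\dots,n-1\}$. An ordinal $\alpha$ is *$m$-possible for $a$* if $\alpha>a(m-1)$ when $m>0$ and $\alpha<a(m+1)$ when $m+1<n$; in that case $a_{m\mapsto\alpha}=(a\setminus\{a(m)\})\cup\{\alpha\}$. * For cardinals $\theta,\kappa$, $\theta^{<\kappa}=\sup\{\theta^{\tau}: \tau<\kappa \text{ a cardinal}\}$. For cardinals $\kappa<\lambda$, $\lambda$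 is *${<}\kappa$-inaccessible* if $\theta^{<\kappa}<\lambda$ for every cardinal $\theta<\lambda$. For $\lambda$ infinite and regular, $\sigma(\lambda,1)=\lambda$ and $\sigma(\lambda,n+1)=\left(2^{<\sigma(\lambda,n)}\right)^+$ for $1\le n<\omega$. **Theorem.** Let $1\le n<\omega$, let $\kappa,\nu<\lambda$ be infinite cardinals with $\lambda$ regular and ${<}\kappa$-inaccessible, and let $\mu=\sigma(\lambda,n)$. Let $g:[\mu]^n\to\nu$, and for each $b\in[\mu]^n$ let $u_b$ be a set of ordinals with $|u_b|<\kappa$. Then there are $H\in[\mu]^\lambda$ and $k<\nu$ such that 1. $g(b)=k$ for all $b\in[H]^n$; 2. $\langle u_b: b\in[H]^n\rangle$ is a uniform $n$-dimensional $\Delta$-system. Moreover, $H$ can be chosen so that, in addition, for all $a,b\in[H]^n$ and all $m<n$: if $a$ and $b$ are aligned above $m$ and $a(m)=b(m)$, then for every $\alpha\in H$ that is $m$-possible for both $a$ and $b$, $$\mathrm{tp}_{\mathrm{int}}(u_a,u_b)=\mathrm{tp}_{\mathrm{int}}\left(u_{a_{m\mapsto\alpha}},u_{b_{m\mapsto\alpha}}\right).$$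 -/

import Mathlib

universe u

namespace DeltaSys

open Cardinal Ordinal Set

/-- `[X]^c`, the collection of all subsets of `X` of cardinality `c`. -/
def cardSubsets (X : Set Ordinal.{u}) (c : Cardinal.{u}) : Set (Set Ordinal.{u}) :=
  {Y | Y ⊆ X ∧ #Y = Cardinal.lift.{u + 1} c}

/-- The order type of a set of ordinals. -/
noncomputable def otp (a : Set Ordinal.{u}) : Ordinal.{u + 1} :=
  Ordinal.type (fun x y : a => x < y)

/-- `a(i)`, the unique element `α` of `a` such that `otp (a ∩ α) = i`;
it is meaningful for `i < otp a` (see `nth_spec` and `nth_unique`). -/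
noncomputable def nth (a : Set Ordinal.{u}) (i : Ordinal.{u + 1}) : Ordinal.{u} :=
  sInf {α | α ∈ a ∧ otp (a ∩ Iio α) = i}

theorem otp_inter_Iio (a : Set Ordinal.{u}) (x : a) :
    otp (a ∩ Iio x.1) = Ordinal.typein (fun x y : a => x < y) x := by
  rw [otp, Ordinal.typein]
  refine Ordinal.type_eq.2 ⟨⟨⟨fun y => ⟨⟨y.1, y.2.1⟩, y.2.2⟩,
    fun y => ⟨y.1.1, y.1.2, y.2⟩, fun _ => rfl, fun _ => rfl⟩, Iff.rfl⟩⟩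

theorem nth_unique {a : Set Ordinal.{u}} {α β : Ordinal.{u}} (hα : α ∈ a) (hβ : β ∈ a)
    (h : otp (a ∩ Iio α) = otp (a ∩ Iio β)) : α = β := by
  have h' : Ordinal.typein (fun x y : a => x < y) ⟨α, hα⟩
      = Ordinal.typein (fun x y : a => x < y) ⟨β, hβ⟩ := by
    rw [← otp_inter_Iio, ← otp_inter_Iio]
    exact h
  exact congrArg Subtype.val (Ordinal.typein_injective (fun x y : a => x < y) h')

theorem nth_spec {a : Set Ordinal.{u}} {i : Ordinal.{u + 1}} (hi : i < otp a) :
    nth a i ∈ a ∧ otp (a ∩ Iio (nth a i)) = i := by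
  obtain ⟨x, hx⟩ := Ordinal.typein_surj (fun x y : a => x < y) hi
  exact csInf_mem (s := {α | α ∈ a ∧ otp (a ∩ Iio α) = i})
    ⟨x.1, x.2, by rw [otp_inter_Iio]; exact hx⟩

/-- `a[I] = {a(i) : i ∈ I}`, for a set `I` of ordinals below `otp a`. -/
def subseq (a : Set Ordinal.{u}) (I : Set Ordinal.{u + 1}) : Set Ordinal.{u} :=
  nth a '' I

/-- `a` and `b` have the same order type, and each common element occupies the same relative
position in `a` and in `b`. -/
def Aligned (a b : Set Ordinal.{u}) : Prop :=
  otp a = otp b ∧ ∀ γ ∈ a ∩ b, otp (a ∩ Iio γ) = otp (b ∩ Iio γ)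

/-- `r(a, b) = {i < otp a : a(i) ∈ b}`. -/
def rset (a b : Set Ordinal.{u}) : Set Ordinal.{u + 1} :=
  {i | i < otp a ∧ nth a i ∈ b}

/-- `⟨u_b : b ∈ [H]^n⟩` is a uniform `n`-dimensional Δ-system. Here a subset of `n` is a set of
ordinals below `n`. -/
def IsUniformDeltaSystem (n : ℕ) (H : Set Ordinal.{u})
    (U : Set Ordinal.{u} → Set Ordinal.{u}) : Prop :=
  ∃ (ρ : Ordinal.{u + 1}) (r : Set Ordinal.{u + 1} → Set Ordinal.{u + 1}),
    (∀ m ⊆ Iio (n : Ordinal.{u + 1}), r m ⊆ Iio ρ) ∧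
    (∀ b ∈ cardSubsets H n, otp (U b) = ρ) ∧
    (∀ a ∈ cardSubsets H n, ∀ b ∈ cardSubsets H n, ∀ m ⊆ Iio (n : Ordinal.{u + 1}),
      Aligned a b → rset a b = m → Aligned (U a) (U b) ∧ rset (U a) (U b) = r m) ∧
    (∀ m₀ ⊆ Iio (n : Ordinal.{u + 1}), ∀ m₁ ⊆ Iio (n : Ordinal.{u + 1}),
      r (m₀ ∩ m₁) = r m₀ ∩ r m₁)

/-- For `a` and `b` of order type `ρ` and `i < ρ`: the sets `a[ρ \ i]` and `b[ρ \ i]` are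
aligned. -/
def AlignedAbove (ρ i : Ordinal.{u + 1}) (a b : Set Ordinal.{u}) : Prop :=
  Aligned (subseq a (Iio ρ \ Iio i)) (subseq b (Iio ρ \ Iio i))

/-- The intersection type `{(i, j) ∈ otp a × otp b : a(i) = b(j)}`. -/
def tpInt (a b : Set Ordinal.{u}) : Set (Ordinal.{u + 1} × Ordinal.{u + 1}) :=
  {p | p.1 < otp a ∧ p.2 < otp b ∧ nth a p.1 = nth b p.2}

/-- `α` is `i`-possible for `a`, where `i < otp a` is finite. -/
def Possible (a : Set Ordinal.{u}) (i : ℕ) (α : Ordinal.{u}) : Prop :=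
  (0 < i → nth a ((i - 1 : ℕ) : Ordinal.{u + 1}) < α) ∧
  (((i + 1 : ℕ) : Ordinal.{u + 1}) < otp a → α < nth a ((i + 1 : ℕ) : Ordinal.{u + 1}))

/-- `a_{i ↦ α} = (a \ {a(i)}) ∪ {α}`. -/
def replaceNth (a : Set Ordinal.{u}) (i : ℕ) (α : Ordinal.{u}) : Set Ordinal.{u} :=
  (a \ {nth a (i : Ordinal.{u + 1})}) ∪ {α}

/-- `σ(lam, n)` for `n ≥ 1`: `σ(lam, 1) = lam` and `σ(lam, n + 1) = (2^{<σ(lam, n)})⁺`.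
The value at `n = 0` is not used. -/
noncomputable def sigma (lam : Cardinal.{u}) : ℕ → Cardinal.{u}
  | 0 => lam
  | 1 => lam
  | n + 2 => Order.succ (2 ^< sigma lam (n + 1))

/-- `lam` is `<κ`-inaccessible: `κ < lam`, and `ν^{<κ} < lam` for every cardinal `ν < lam`. -/
def LtInaccessible (κ lam : Cardinal.{u}) : Prop :=
  κ < lam ∧ ∀ ν < lam, ν ^< κ < lam

end DeltaSys

namespace DeltaSys

open Cardinal Ordinal Set

/-! Each `u_b` is replaced by an injective enumeration over its positions, with the order type made
part of the colour, and `b` by an increasing tuple. Both conclusions then concern only which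
equalities `F x i = F y j` hold. `HasDeltaSystems` is this form of the theorem, proved by induction
on the dimension. Dimension one is the classical Δ-system lemma (`IsInitial.exists_deltaSystem`).

The inductive step follows the Erdős–Rado pattern. In `(2^{<τ})⁺` there is a point `δ` whose small
sets of facts over smaller points are reflected below `δ` (`IsInitial.exists_reflecting`). Hence
some `τ`-sequence below `δ` has every term looking like `δ` over the earlier terms
(`IsInitial.exists_end_homogeneous`). Fixing the last coordinate at `δ` gives an `n`-dimensional
family `G` on this sequence. The induction hypothesis applies to it, with a colour that also records
the set `s` of indices whose element already occurs below `δ`.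

Over tuples with equal last coordinates, the original family intersects as `G` does. For different
last coordinates, after a further thinning (`IsRoots.exists_isNext`), elements coincide exactly when
both indices lie in `s` and `G` makes them coincide (`IsEndReflection.snoc_eq_snoc_iff`). So the new
root is the root of `G`, cut down to `s` when the last coordinate is not shared. Shift invariance
follows from the same two cases. -/

/-- A linear order of cardinality `c` all of whose proper initial segments are smaller. For
well-orders this says that the order type is the initial ordinal of `c`. -/
structure IsInitial (L : Type u) [LinearOrder L] (c : Cardinal.{u}) : Prop where
  mk_eq : #L = c
  mk_Iio_lt : ∀ a : L, #(Iio a) < c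

theorem isInitial_toType_ord (c : Cardinal.{u}) : IsInitial c.ord.ToType c :=
  ⟨by simp, fun a => by simpa using Cardinal.mk_Iio_lt a (by simp)⟩

/-! ### Initial well-orders: recursion and closure points -/

section Initial

variable {L : Type u} [LinearOrder L] {c : Cardinal.{u}}

theorem IsInitial.mk_Iic_lt (hL : IsInitial L c) (hc : ℵ₀ ≤ c) (a : L) : #(Iic a) < c := by
  rw [← Iio_insert]
  exact (mk_insert_le).trans_lt (add_lt_of_lt hc (hL.mk_Iio_lt a) (one_lt_aleph0.trans_le hc))

theorem IsInitial.exists_forall_lt (hL : IsInitial L c) (hc : c.IsRegular) (S : Set L)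
    (hS : #S < c) : ∃ b, ∀ s ∈ S, s < b := by
  by_contra! h
  have h1 : (Set.univ : Set L) = ⋃ s : S, Iic s.1 := by
    ext b
    obtain ⟨s, hs, hb⟩ := h b
    simp only [mem_univ, mem_iUnion, true_iff]
    exact ⟨⟨s, hs⟩, hb⟩
  have h2 : #(⋃ s : S, Iic s.1) < c :=
    (card_iUnion_lt_iff_forall_of_isRegular hc hS).2 fun s => hL.mk_Iic_lt hc.aleph0_le _
  rw [← h1, mk_univ, hL.mk_eq] at h2
  exact h2.false

theorem IsInitial.exists_gt (hL : IsInitial L c) (hc : ℵ₀ ≤ c) (a : L) : ∃ b, a < b := by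
  by_contra! h
  have : #(Iic a) < c := hL.mk_Iic_lt hc a
  rw [show Iic a = Set.univ from eq_univ_of_forall h, mk_univ, hL.mk_eq] at this
  exact this.false

/-- Recursive construction of a sequence whose terms are related to the set of earlier terms. -/
theorem exists_seq_of_forall_small [WellFoundedLT L] (hL : ∀ a : L, #(Iio a) < c) {Y : Type u}
    (R : Set Y → Y → Prop) (h : ∀ S : Set Y, #S < c → ∃ y, R S y) :
    ∃ e : L → Y, ∀ ξ, R (e '' Iio ξ) (e ξ) := by
  classical
  rcases isEmpty_or_nonempty Y with hY | ⟨⟨y₀⟩⟩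
  · refine ⟨fun ξ => (hY.false (h ∅ ?_).choose).elim, fun ξ => (hY.false (h ∅ ?_).choose).elim⟩ <;>
    · rw [mk_eq_zero]
      exact zero_le.trans_lt (hL ξ)
  let pick : Set Y → Y := fun S => if hS : ∃ y, R S y then hS.choose else y₀
  have hpick : ∀ S, (∃ y, R S y) → R S (pick S) := fun S hS => by
    simp only [pick, dif_pos hS]
    exact hS.choose_spec
  let e : L → Y := WellFounded.fix (C := fun _ => Y) (wellFounded_lt (α := L))
    fun ξ prev => pick {y | ∃ η, ∃ hη : η < ξ, prev η hη = y}
  have he : ∀ ξ, e ξ = pick (e '' Iio ξ) := fun ξ => by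
    have := WellFounded.fix_eq (C := fun _ => Y) (wellFounded_lt (α := L))
      (fun ξ prev => pick {y | ∃ η, ∃ hη : η < ξ, prev η hη = y}) ξ
    rw [show e ξ = _ from this]
    congr 1
    ext y
    simp [e]
  refine ⟨e, fun ξ => ?_⟩
  conv => arg 2; rw [he ξ]
  exact hpick _ (h _ (mk_image_le.trans_lt (hL ξ)))

/-- A function on a regular cardinal has closure points of every smaller regular cofinality. -/
theorem IsInitial.exists_closed_point [WellFoundedLT L] (hL : IsInitial L c) (hc : c.IsRegular)
    {χ : Cardinal.{u}} (hχ : χ.IsRegular) (hχc : χ < c) (f : L → L) :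
    ∃ δ : L, (∀ γ < δ, f γ < δ) ∧ (∃ γ, γ < δ) ∧
      ∀ S : Set L, (∀ s ∈ S, s < δ) → #S < χ → ∃ γ < δ, ∀ s ∈ S, s < γ := by
  have hD := isInitial_toType_ord χ
  obtain ⟨e, he⟩ := exists_seq_of_forall_small (L := χ.ord.ToType) hD.mk_Iio_lt
    (fun (S : Set L) y => ∀ s ∈ S, s < y ∧ ∀ t ≤ s, f t < y) (by
      intro S hS
      have hS' : #S < c := hS.trans hχc
      have h1 : #(⋃ s : S, insert s.1 (f '' Iic s.1)) < c := by
        refine (card_iUnion_lt_iff_forall_of_isRegular hc hS').2 fun s => ?_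
        exact (mk_insert_le).trans_lt (add_lt_of_lt hc.aleph0_le
          (mk_image_le.trans_lt (hL.mk_Iic_lt hc.aleph0_le _))
          (one_lt_aleph0.trans_le hc.aleph0_le))
      obtain ⟨b, hb⟩ := hL.exists_forall_lt hc _ h1
      refine ⟨b, fun s hs => ⟨hb s ?_, fun t ht => hb _ ?_⟩⟩
      · exact mem_iUnion.2 ⟨⟨s, hs⟩, mem_insert _ _⟩
      · exact mem_iUnion.2 ⟨⟨s, hs⟩, mem_insert_of_mem _ ⟨t, ht, rfl⟩⟩)
  have hmono : ∀ η ξ, η < ξ → e η < e ξ := fun η ξ h => (he ξ _ ⟨η, h, rfl⟩).1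
  have hne : {b : L | ∀ ξ, e ξ < b}.Nonempty := by
    obtain ⟨b, hb⟩ := hL.exists_forall_lt hc (range e)
      (mk_range_le.trans_lt (by rwa [hD.mk_eq]))
    exact ⟨b, fun ξ => hb _ ⟨ξ, rfl⟩⟩
  -- `δ` is the supremum of an increasing sequence of length `χ`, so fewer than `χ` points below it
  -- are bounded below it. Each term exceeds the values of `f` up to any earlier term, which gives
  -- closure.
  let δ := (wellFounded_lt (α := L)).min _ hne
  have hδ : ∀ ξ, e ξ < δ := (wellFounded_lt (α := L)).min_mem _ hne
  have hδ' : ∀ γ < δ, ∃ ξ, γ ≤ e ξ := by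
    intro γ hγ
    by_contra! h
    exact (wellFounded_lt (α := L)).not_lt_min {b | ∀ ξ, e ξ < b} h hγ
  have : Nonempty χ.ord.ToType := by
    rw [← mk_ne_zero_iff, hD.mk_eq]
    exact hχ.ne_zero
  refine ⟨δ, ?_, ⟨e (Classical.arbitrary _), hδ _⟩, ?_⟩
  · intro γ hγ
    obtain ⟨ξ, hξ⟩ := hδ' γ hγ
    obtain ⟨ξ', h'⟩ := hD.exists_gt hχ.aleph0_le ξ
    exact ((he ξ' _ ⟨ξ, h', rfl⟩).2 γ hξ).trans (hδ _)
  · intro S hS hSχ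
    choose! ξ hξ using hδ'
    obtain ⟨ξ₀, h₀⟩ := hD.exists_forall_lt hχ (ξ '' S) (mk_image_le.trans_lt hSχ)
    exact ⟨e ξ₀, hδ _, fun s hs => (hξ s (hS s hs)).trans_lt (hmono _ _ (h₀ _ ⟨s, hs, rfl⟩))⟩

end Initial

/-! ### Counting small subsets -/

section Counting

variable {τ : Cardinal.{u}}

theorem le_two_powerlt (τ : Cardinal.{u}) : τ ≤ 2 ^< τ := by
  refine le_of_forall_lt fun d hd => (cantor d).trans_le (le_powerlt _ hd)

theorem mk_Iio_toType_mk {d : Cardinal.{u}} (hd : d < τ) :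
    #(Iio (Ordinal.ToType.mk ⟨d.ord, ord_lt_ord.2 hd⟩ : τ.ord.ToType)) = d := by
  refine (card_typein (r := (· < ·)) _).symm.trans ?_
  exact (congrArg card (typein_enum (α := τ.ord.ToType) (· < ·) _)).trans (card_ord d)

/-- There are at most `2^{<τ}` subsets of size less than `τ` of a set of size at most `2^{<τ}`. -/
theorem mk_small_subsets_le (hτ : τ.IsRegular) (hτ' : ℵ₀ < τ) {α : Type u} (Y : Set α)
    (hY : #Y ≤ 2 ^< τ) : #{S : Set α | S ⊆ Y ∧ #S < τ} ≤ 2 ^< τ := by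
  let D := τ.ord.ToType
  have hD : IsInitial D τ := isInitial_toType_ord τ
  -- `T` is large enough to contain a copy of `Y`, and it is stratified along the regular cardinal
  -- `τ`, so a small subset lies below one level. The part below level `d` has at most `2 ^ max ℵ₀
  -- |d|` elements.
  let T := Σ d : D, Set (Iio d)
  have hT : 2 ^< τ ≤ #T := by
    refine powerlt_le.2 fun d hd => ?_
    have : #(Set (Iio (Ordinal.ToType.mk ⟨d.ord, ord_lt_ord.2 hd⟩ : D))) = 2 ^ d := by
      rw [mk_set, mk_Iio_toType_mk hd]
    rw [← this]
    exact mk_le_of_injective (f := fun s => (⟨_, s⟩ : T))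
      (sigma_mk_injective (β := fun d : D => Set (Iio d)))
  obtain ⟨j⟩ : Nonempty (Y ↪ T) := hY.trans hT
  let Td : D → Set T := fun d => {t | t.1 < d}
  have hTd : ∀ d, #(Td d) ≤ 2 ^ (max ℵ₀ #(Iio d)) := by
    intro d
    have h1 : #(Td d) ≤ #(Σ d' : Iio d, Set (Iio d'.1)) :=
      mk_le_of_injective (f := fun t => ⟨⟨t.1.1, t.2⟩, t.1.2⟩) (by
        rintro ⟨⟨a, s⟩, ha⟩ ⟨⟨b, t⟩, hb⟩ h
        obtain ⟨h1, h2⟩ := Sigma.mk.inj h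
        obtain rfl : a = b := congrArg Subtype.val h1
        obtain rfl := eq_of_heq h2
        rfl)
    refine h1.trans ?_
    rw [mk_sigma]
    refine (sum_le_mk_mul_iSup _).trans ?_
    have h2 : (⨆ i : Iio d, #(Set (Iio i.1))) ≤ 2 ^ (max ℵ₀ #(Iio d)) := by
      refine ciSup_le' fun i => ?_
      rw [mk_set]
      refine power_le_power_left two_ne_zero (le_max_of_le_right ?_)
      exact mk_le_mk_of_subset (Iio_subset_Iio i.2.le)
    refine (mul_le_mul' ((cantor _).le.trans
      (power_le_power_left two_ne_zero (le_max_right ℵ₀ _))) h2).trans ?_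
    rw [← power_add, add_eq_self (le_max_left _ _)]
  let B : D → Set (Set T) := fun d => {t | t ⊆ Td d ∧ #t ≤ #(Iio d)}
  have hB : ∀ d, #(B d) ≤ 2 ^< τ := by
    intro d
    refine (mk_bounded_subset_le (Td d) #(Iio d)).trans ?_
    have h1 : max #(Td d) ℵ₀ ≤ 2 ^ (max ℵ₀ #(Iio d)) :=
      max_le (hTd d) ((le_max_left _ _).trans (cantor _).le)
    refine (power_le_power_right h1).trans ?_
    rw [← power_mul]
    refine (power_le_power_left two_ne_zero (mul_le_mul' le_rfl (le_max_right ℵ₀ _))).trans ?_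
    rw [mul_eq_self (le_max_left _ _)]
    exact le_powerlt _ (max_lt hτ' (hD.mk_Iio_lt d))
  have hU : #(⋃ d, B d) ≤ 2 ^< τ := by
    refine (mk_iUnion_le _).trans ?_
    rw [hD.mk_eq]
    refine (mul_le_mul' (le_two_powerlt τ) (ciSup_le' hB)).trans ?_
    exact (mul_eq_self (hτ.aleph0_le.trans (le_two_powerlt τ))).le
  refine le_trans (mk_le_of_injective
    (f := fun S : {S : Set α | S ⊆ Y ∧ #S < τ} =>
      (⟨j '' (Subtype.val ⁻¹' S.1), ?_⟩ : ↥(⋃ d, B d))) ?_) hU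
  · have hS : #(j '' (Subtype.val ⁻¹' S.1)) < τ :=
      (mk_image_le.trans (mk_preimage_of_injective _ _ Subtype.val_injective)).trans_lt S.2.2
    obtain ⟨d, hd⟩ := hD.exists_forall_lt hτ (Sigma.fst '' (j '' (Subtype.val ⁻¹' S.1)))
      (mk_image_le.trans_lt hS)
    let d' : D := Ordinal.ToType.mk ⟨_, ord_lt_ord.2 hS⟩
    -- `d` bounds the levels that occur, and `d'` has exactly as many predecessors as the set has
    -- elements; their maximum serves both clauses of `B`.
    refine mem_iUnion.2 ⟨max d d', fun t ht => (hd _ ⟨t, ht, rfl⟩).trans_le (le_max_left _ _), ?_⟩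
    rw [← mk_Iio_toType_mk hS]
    exact mk_le_mk_of_subset (Iio_subset_Iio (le_max_right _ _))
  · rintro ⟨S, hS⟩ ⟨S', hS'⟩ h
    simp only [Subtype.mk.injEq] at h
    have := j.injective.image_injective h
    rw [Subtype.preimage_val_eq_preimage_val_iff] at this
    simp only [Subtype.mk.injEq]
    rwa [inter_eq_right.2 hS.1, inter_eq_right.2 hS'.1] at this

end Counting

/-! ### Reflecting points -/

/-- In the successor of `2^{<τ}` there is a point `δ` whose behaviour over every small set of
facts about smaller points is reflected cofinally often below `δ`. -/
theorem IsInitial.exists_reflecting {L : Type u} [LinearOrder L] [WellFoundedLT L]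
    {τ : Cardinal.{u}} (hτ : τ.IsRegular) (hτ' : ℵ₀ < τ) (hL : IsInitial L (Order.succ (2 ^< τ)))
    {P : Type u} (T : L → Set P) (Q : L → Set P) (hQ : Monotone Q) (hQc : ∀ γ, #(Q γ) ≤ 2 ^< τ) :
    ∃ δ : L, (∃ γ, γ < δ) ∧
      (∀ S : Set L, (∀ s ∈ S, s < δ) → #S < τ → ∃ γ < δ, ∀ s ∈ S, s < γ) ∧
      ∀ S : Set P, (∀ p ∈ S, ∃ γ < δ, p ∈ Q γ) → #S < τ → ∀ γ < δ, ∃ α < δ, γ ≤ α ∧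
        ∀ p ∈ S, p ∈ T α ↔ p ∈ T δ := by
  have hθ : ℵ₀ ≤ 2 ^< τ := hτ.aleph0_le.trans (le_two_powerlt τ)
  have hreg : (Order.succ (2 ^< τ)).IsRegular := isRegular_succ hθ
  -- There are at most `2^{<τ}` pairs of a small `S ⊆ Q γ` and a trace on it. One `b` therefore
  -- bounds a chosen witness for every trace that is realised from `γ` on.
  have key : ∀ γ : L, ∃ b : L, ∀ S ⊆ Q γ, #S < τ → ∀ β, γ ≤ β → ∃ α < b, γ ≤ α ∧
      T α ∩ S = T β ∩ S := by
    intro γ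
    let Z : Set (Set P) := {S | S ⊆ Q γ ∧ #S < τ}
    have hZ : #Z ≤ 2 ^< τ := mk_small_subsets_le hτ hτ' _ (hQc γ)
    have hex : ∀ p : Z × Z, ∃ α : L, (∃ β, γ ≤ β ∧ T β ∩ p.1.1 = p.2.1) →
        γ ≤ α ∧ T α ∩ p.1.1 = p.2.1 := fun p => by
      by_cases h : ∃ β, γ ≤ β ∧ T β ∩ p.1.1 = p.2.1
      · exact ⟨h.choose, fun _ => h.choose_spec⟩
      · exact ⟨γ, fun h' => (h h').elim⟩
    choose a ha using hex
    obtain ⟨b, hb⟩ := hL.exists_forall_lt hreg (range a) (by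
      refine mk_range_le.trans_lt (Order.lt_succ_of_le ?_)
      rw [mk_prod, Cardinal.lift_id]
      exact (mul_le_mul' hZ hZ).trans (mul_eq_self hθ).le)
    refine ⟨b, fun S hS hSτ β hβ => ?_⟩
    let p : Z × Z := (⟨S, hS, hSτ⟩, ⟨T β ∩ S, inter_subset_right.trans hS,
      (mk_le_mk_of_subset inter_subset_right).trans_lt hSτ⟩)
    exact ⟨a p, hb _ ⟨p, rfl⟩, ha p ⟨β, hβ, rfl⟩⟩
  choose f hf using key
  obtain ⟨δ, h1, h2, h3⟩ := hL.exists_closed_point hreg hτ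
    (Order.lt_succ_of_le (le_two_powerlt τ)) f
  refine ⟨δ, h2, h3, fun S hS hSτ γ hγ => ?_⟩
  have : Nonempty L := ⟨δ⟩
  choose! g hg hg' using hS
  -- Cofinality `τ` puts all of `S` inside one `Q γ'`. The trace of `δ` itself is then realised
  -- below `δ` by closure under `f`.
  obtain ⟨γ', hγ', hγS⟩ := h3 (g '' S) (by rintro _ ⟨p, hp, rfl⟩; exact hg p hp)
    (mk_image_le.trans_lt hSτ)
  have hm : max γ γ' < δ := max_lt hγ hγ'
  obtain ⟨α, hα, hα', h⟩ := hf (max γ γ') S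
    (fun p hp => hQ ((hγS _ ⟨p, hp, rfl⟩).le.trans (le_max_right _ _)) (hg' p hp)) hSτ δ hm.le
  refine ⟨α, hα.trans (h1 _ hm), (le_max_left _ _).trans hα', fun p hp => ?_⟩
  have := Set.ext_iff.1 h p
  simpa [hp] using this

/-! ### Increasing tuples, roots and splicing -/

section Tuples

variable {n : ℕ} {Λ : Type u} {ι X : Type u}

/-- Two tuples are aligned if common values occur at the same position. -/
def TupleAligned (x y : Fin n → Λ) : Prop := ∀ p q, x p = y q → p = q

variable [LinearOrder Λ]

/-- `r` witnesses that a family of indexed sets over increasing tuples is a uniform Δ-system. -/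
structure IsRoots (r : Set (Fin n) → Set ι) (G : (Fin n → Λ) → ι → X) : Prop where
  eq_iff : ∀ x y, StrictMono x → StrictMono y → TupleAligned x y →
    ∀ i j, G x i = G y j ↔ i = j ∧ i ∈ r {p | x p = y p}
  inter : ∀ m m', r (m ∩ m') = r m ∩ r m'

/-- Moving a common entry above which two tuples are aligned does not change intersection
types. -/
def ShiftInvariant (G : (Fin n → Λ) → ι → X) : Prop :=
  ∀ x y, StrictMono x → StrictMono y → ∀ m : Fin n,
    (∀ p q, m ≤ p → m ≤ q → x p = y q → p = q) → x m = y m →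
    ∀ α, StrictMono (Function.update x m α) → StrictMono (Function.update y m α) →
      ∀ i j, G x i = G y j ↔ G (Function.update x m α) i = G (Function.update y m α) j

/-- The initial segment of length `c` of the positions of an `n`-tuple. -/
def low (n c : ℕ) : Set (Fin n) := {p | p.1 < c}

/-- The tuple with the first `c` entries of `x` and the other entries of `t`. -/
def splice (x t : Fin n → Λ) (c : ℕ) : Fin n → Λ := fun p => if p.1 < c then x p else t p

theorem strictMono_splice {x t : Fin n → Λ} {c : ℕ} (hx : StrictMono x) (ht : StrictMono t)
    (h : ∀ p q : Fin n, p.1 < c → x p < t q) : StrictMono (splice x t c) := by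
  intro p q hpq
  have hpq' : p.1 < q.1 := hpq
  unfold splice
  split_ifs with h1 h2 h2
  · exact hx hpq
  · exact h _ _ h1
  · omega
  · exact ht hpq

theorem strictMono_snoc {x : Fin n → Λ} {a : Λ} (hx : StrictMono x) (ha : ∀ p, x p < a) :
    StrictMono (Fin.snoc (α := fun _ => Λ) x a : Fin (n + 1) → Λ) := by
  intro p q hpq
  induction q using Fin.lastCases with
  | last =>
    induction p using Fin.lastCases with
    | last => exact (lt_irrefl _ hpq).elim
    | cast p => simpa using ha p
  | cast q =>
    induction p using Fin.lastCases with
    | last => exact absurd hpq (Fin.castSucc_lt_last q).not_gt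
    | cast p => simpa using hx (Fin.castSucc_lt_castSucc_iff.1 hpq)

theorem exists_forall_lt_iff_val_lt {y : Fin n → Λ} (hy : StrictMono y) (a : Λ) :
    ∃ c ≤ n, ∀ q : Fin n, y q < a ↔ q.1 < c := by
  classical
  have h : ∃ c, c = n ∨ ∃ hc : c < n, a ≤ y ⟨c, hc⟩ := ⟨n, Or.inl rfl⟩
  refine ⟨Nat.find h, Nat.find_min' h (Or.inl rfl), fun q => ⟨fun hq => ?_, fun hq => ?_⟩⟩
  · by_contra! hc
    rcases Nat.find_spec h with h1 | ⟨h1, h2⟩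
    · omega
    · exact (h2.trans (hy.monotone (show (⟨Nat.find h, h1⟩ : Fin n) ≤ q from hc))).not_gt hq
  · have := Nat.find_min h hq
    push Not at this
    exact this.2 q.2

theorem IsRoots.mono {r : Set (Fin n) → Set ι} {G : (Fin n → Λ) → ι → X} (hr : IsRoots r G)
    {m m' : Set (Fin n)} (h : m ⊆ m') : r m ⊆ r m' := by
  rw [← inter_eq_left.2 h, hr.inter]
  exact inter_subset_right

/-- An index in the root of the first `c` positions names an element that depends on those entries
only. The other entries may be exchanged as long as the two tuples stay aligned, which `h` and `h'`
ensure. -/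
theorem IsRoots.splice_eq {r : Set (Fin n) → Set ι} {G : (Fin n → Λ) → ι → X} (hr : IsRoots r G)
    {x t : Fin n → Λ} {c : ℕ} (hx : StrictMono x) (ht : StrictMono t)
    (h : ∀ p q : Fin n, p.1 < c → x p < t q) (h' : ∀ p q : Fin n, c ≤ p.1 → x p ≠ t q)
    {i : ι} (hi : i ∈ r (low n c)) : G (splice x t c) i = G x i := by
  refine (hr.eq_iff _ _ (strictMono_splice hx ht h) hx ?_ i i).2 ⟨rfl, hr.mono ?_ hi⟩
  · intro p q hpq
    unfold splice at hpq
    split_ifs at hpq with h1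
    · exact hx.injective hpq
    · rcases lt_or_ge q.1 c with h2 | h2
      · exact absurd hpq (h _ _ h2).ne'
      · exact absurd hpq.symm (h' _ _ h2)
  · intro p hp
    have hp' : p.1 < c := hp
    simp [splice, hp']

theorem mk_fin_fun_lt {c : Cardinal.{u}} (hc : ℵ₀ < c) {α : Type u} (hα : #α < c) (k : ℕ) :
    #(Fin k → α) < c := by
  have : #(Fin k → α) = #α ^ k := by simp
  rw [this]
  exact (power_nat_le_max).trans_lt (max_lt hα hc)

theorem IsInitial.exists_strictMono_gt {c : Cardinal.{u}} (hL : IsInitial Λ c) (hc : ℵ₀ ≤ c)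
    (b : Λ) (n : ℕ) : ∃ t : Fin n → Λ, StrictMono t ∧ ∀ p, b < t p := by
  induction n with
  | zero => exact ⟨fun _ => b, fun p => p.elim0, fun p => p.elim0⟩
  | succ n ih =>
    obtain ⟨t, ht, hb⟩ := ih
    obtain ⟨a, ha⟩ : ∃ a, b < a ∧ ∀ p, t p < a := by
      rcases n with _ | n
      · obtain ⟨a, ha⟩ := hL.exists_gt hc b
        exact ⟨a, ha, fun p => p.elim0⟩
      · obtain ⟨a, ha⟩ := hL.exists_gt hc (t (Fin.last n))
        exact ⟨a, (hb _).trans ha, fun p => (ht.monotone (Fin.le_last p)).trans_lt ha⟩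
    refine ⟨Fin.snoc (α := fun _ => Λ) t a, strictMono_snoc ht ha.2, fun p => ?_⟩
    induction p using Fin.lastCases with
    | last => simpa using ha.1
    | cast p => simpa using hb p

end Tuples

/-! ### Choosing the next point of a thinned-out set -/

section Thinning

variable {n : ℕ} {Λ : Type u} [LinearOrder Λ] {ι X : Type u} {lam : Cardinal.{u}}

/-- `y` can follow the points of `S` in a thinned-out set: there is room for `n` points between
`S` and `y`, and no element that depends on `y` as the last coordinate belongs to a set
given by points of `S`. -/
structure IsNext (r : Set (Fin n) → Set ι) (G : (Fin n → Λ) → ι → X)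
    (K : (Fin (n + 1) → Λ) → ι → X) (S : Set Λ) (y : Λ) : Prop where
  lt : ∀ s ∈ S, s < y
  room : ∃ t : Fin n → Λ, StrictMono t ∧ (∀ s ∈ S, ∀ p, s < t p) ∧ ∀ p, t p < y
  ne : ∀ z : Fin (n + 1) → Λ, (∀ p, z p ∈ S) → ∀ x : Fin n → Λ, StrictMono x → ∀ l : Fin n,
    x l = y → (∀ p < l, x p ∈ S) → ∀ i j, j ∉ r (low n l) → j ∈ r (low n (l + 1)) → G x j ≠ K z i

/-- Otherwise give both tuples a common tail far above them. They become aligned, and among the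
first `l + 1` positions they agree only below `l`. By the intersection law `j` would then lie in the
root of the first `l` positions. -/
theorem IsRoots.eq_of_eq {r : Set (Fin n) → Set ι} {G : (Fin n → Λ) → ι → X}
    (hr : IsRoots r G) (hΛ : IsInitial Λ lam) (hlam : ℵ₀ ≤ lam)
    {x x' : Fin n → Λ} (hx : StrictMono x) (hx' : StrictMono x') {l : Fin n}
    (h : ∀ p < l, x p = x' p) {j : ι} (hj : j ∉ r (low n l)) (hj' : j ∈ r (low n (l + 1)))
    (hG : G x j = G x' j) : x l = x' l := by
  by_contra hne
  have : NeZero n := ⟨fun h0 => by subst h0; exact l.elim0⟩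
  obtain ⟨t, ht, htb⟩ := hΛ.exists_strictMono_gt hlam (max (x (Fin.ofNat n (n - 1)))
    (x' (Fin.ofNat n (n - 1)))) n
  have hle : ∀ p : Fin n, p ≤ Fin.ofNat n (n - 1) := fun p => by
    rw [Fin.le_def, Fin.val_ofNat, Nat.mod_eq_of_lt (by have := p.2; omega)]
    have := p.2
    omega
  have h1 : ∀ p q, x p < t q := fun p q =>
    ((hx.monotone (hle p)).trans (le_max_left _ _)).trans_lt (htb q)
  have h2 : ∀ p q, x' p < t q := fun p q =>
    ((hx'.monotone (hle p)).trans (le_max_right _ _)).trans_lt (htb q)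
  have e1 := hr.splice_eq hx ht (fun p q _ => h1 p q) (fun p q _ => (h1 p q).ne) hj'
  have e2 := hr.splice_eq hx' ht (fun p q _ => h2 p q) (fun p q _ => (h2 p q).ne) hj'
  have hG' : G (splice x t (l + 1)) j = G (splice x' t (l + 1)) j := by rw [e1, e2, hG]
  have hal : TupleAligned (splice x t (l + 1)) (splice x' t (l + 1)) := by
    intro p q hpq
    unfold splice at hpq
    split_ifs at hpq with h3 h4 h4
    · rcases lt_or_ge p l with hp | hp
      · exact hx'.injective ((h p hp).symm.trans hpq)
      · rcases lt_or_ge q l with hq | hq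
        · exact hx.injective (hpq.trans (h q hq).symm)
        · rw [Fin.le_def] at hp hq
          exact Fin.ext (by omega)
    · exact absurd hpq (h1 _ _).ne
    · exact absurd hpq (h2 _ _).ne'
    · exact ht.injective hpq
  have hm := ((hr.eq_iff _ _ (strictMono_splice hx ht fun p q _ => h1 p q)
    (strictMono_splice hx' ht fun p q _ => h2 p q) hal j j).1 hG').2
  have hm' : j ∈ r ({p | splice x t (l + 1) p = splice x' t (l + 1) p} ∩ low n (l + 1)) := by
    rw [hr.inter]
    exact ⟨hm, hj'⟩
  refine hj (hr.mono ?_ hm')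
  rintro p ⟨hp1, hp2⟩
  have hp2' : p.1 < l.1 + 1 := hp2
  have hp1' : splice x t (l + 1) p = splice x' t (l + 1) p := hp1
  simp only [splice, hp2', if_true] at hp1'
  have : p ≠ l := by rintro rfl; exact hne hp1'
  have : p.1 ≠ l.1 := fun h => this (Fin.ext h)
  show p.1 < l.1
  omega

/-- By `IsRoots.eq_of_eq`, a point violating the last clause of `IsNext` is determined by finitely
many parameters from `S`, a position and two indices. There are fewer than `lam` such points, so
they are bounded. -/
theorem IsRoots.exists_isNext {r : Set (Fin n) → Set ι} {G : (Fin n → Λ) → ι → X}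
    (hr : IsRoots r G) (hΛ : IsInitial Λ lam) (hlam : lam.IsRegular) (hlam' : ℵ₀ < lam)
    (hι : #ι < lam) (K : (Fin (n + 1) → Λ) → ι → X) (S : Set Λ) (hS : #S < lam) :
    ∃ y, IsNext r G K S y := by
  classical
  obtain ⟨b, hb⟩ := hΛ.exists_forall_lt hlam S hS
  obtain ⟨t, ht, htb⟩ := hΛ.exists_strictMono_gt hlam.aleph0_le b n
  obtain ⟨b', hb'⟩ := hΛ.exists_forall_lt hlam (insert b (range t))
    ((((finite_range t).insert b).lt_aleph0).trans hlam')
  let B : Set Λ := {y | ∃ z : Fin (n + 1) → Λ, (∀ p, z p ∈ S) ∧ ∃ x : Fin n → Λ, StrictMono x ∧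
    ∃ l : Fin n, x l = y ∧ (∀ p < l, x p ∈ S) ∧ ∃ i j, j ∉ r (low n l) ∧ j ∈ r (low n (l + 1)) ∧
      G x j = K z i}
  have hB : #B < lam := by
    have hB' : ∀ y : B, ∃ z : Fin (n + 1) → Λ, (∀ p, z p ∈ S) ∧ ∃ x : Fin n → Λ, StrictMono x ∧
      ∃ l : Fin n, x l = y ∧ (∀ p < l, x p ∈ S) ∧ ∃ i j, j ∉ r (low n l) ∧
        j ∈ r (low n (l + 1)) ∧ G x j = K z i := fun y => y.2
    choose z hz x hx l hl hxS i j hj hj' hG using hB'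
    -- Entries of `x` from position `l` on need not lie in `S`; `none` takes their places.
    let w : B → (Fin (n + 1) → S) × Fin n × (Fin n → Option S) × ι × ι := fun y =>
      (fun p => ⟨z y p, hz y p⟩, l y,
        fun p => if hp : p < l y then some ⟨x y p, hxS y p hp⟩ else none, i y, j y)
    have hw : Function.Injective w := by
      intro y y' h
      simp only [w, Prod.mk.injEq] at h
      obtain ⟨h1, h2, h3, h4, h5⟩ := h
      have hzz : z y = z y' := by
        funext p
        exact congrArg Subtype.val (congrFun h1 p)
      have hxx : ∀ p < l y, x y p = x y' p := by
        intro p hp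
        have := congrFun h3 p
        rw [dif_pos hp, dif_pos (h2 ▸ hp)] at this
        exact congrArg Subtype.val (Option.some.inj this)
      have hGG : G (x y) (j y) = G (x y') (j y) := by
        rw [hG y, h5, hG y', hzz, h4]
      have := hr.eq_of_eq hΛ hlam.aleph0_le (hx y) (hx y') hxx (hj y) (hj' y) hGG
      rw [hl y, h2, hl y'] at this
      exact Subtype.ext this
    refine (mk_le_of_injective (f := fun y => (⟨(w y).1, ULift.up (w y).2.1, (w y).2.2⟩ :
      (Fin (n + 1) → S) × ULift.{u} (Fin n) × (Fin n → Option S) × ι × ι)) ?_).trans_lt ?_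
    · intro y y' h
      apply hw
      simp only [Prod.mk.injEq, ULift.up.injEq] at h
      exact Prod.ext h.1 (Prod.ext h.2.1 h.2.2)
    · simp only [mk_prod, Cardinal.lift_id]
      have hO : #(Option S) < lam := by
        rw [mk_option]
        exact add_lt_of_lt hlam.aleph0_le hS (one_lt_aleph0.trans hlam')
      have hF : #(ULift.{u} (Fin n)) < lam := (lt_aleph0_of_finite _).trans hlam'
      exact mul_lt_of_lt hlam.aleph0_le (mk_fin_fun_lt hlam' hS _)
        (mul_lt_of_lt hlam.aleph0_le hF (mul_lt_of_lt hlam.aleph0_le (mk_fin_fun_lt hlam' hO _)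
          (mul_lt_of_lt hlam.aleph0_le hι hι)))
  obtain ⟨y, hy⟩ := hΛ.exists_forall_lt hlam (insert b' B) ((mk_insert_le).trans_lt
    (add_lt_of_lt hlam.aleph0_le hB (one_lt_aleph0.trans hlam')))
  have hby : b' < y := hy _ (mem_insert _ _)
  refine ⟨y, fun s hs => ((hb s hs).trans (hb' _ (mem_insert _ _))).trans hby,
    ⟨t, ht, fun s hs p => (hb s hs).trans (htb p),
      fun p => (hb' _ (mem_insert_of_mem _ ⟨p, rfl⟩)).trans hby⟩, ?_⟩
  intro z hz x hx l hl hxS i j hj hj' hG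
  exact (hy y (mem_insert_of_mem _ ⟨z, hz, x, hx, l, hl, hxS, i, j, hj, hj', hG⟩)).false

end Thinning

/-! ### From `n`-tuples to `(n + 1)`-tuples -/

theorem snoc_castSucc_last {n : ℕ} {Λ : Type u} (z : Fin (n + 1) → Λ) :
    Fin.snoc (α := fun _ => Λ) (fun p : Fin n => z p.castSucc) (z (Fin.last n)) = z :=
  Fin.snoc_init_self z

theorem comp_snoc {n : ℕ} {Λ Λ' : Type u} (h : Λ → Λ') (x : Fin n → Λ) (a : Λ) :
    (h ∘ Fin.snoc (α := fun _ => Λ) x a : Fin (n + 1) → Λ') =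
      Fin.snoc (α := fun _ => Λ') (h ∘ x) (h a) := by
  funext p
  induction p using Fin.lastCases with
  | last => simp
  | cast p => simp

section EndExtension

variable {n : ℕ} {Λ : Type u} [LinearOrder Λ] {ι X : Type u} {lam : Cardinal.{u}}

/-- The families `K` on `(n + 1)`-tuples and `G` on `n`-tuples behave as if `G x` were
`K (x, δ)` for a point `δ` that every point of `Λ` reflects over the earlier points; `W` is the
set of elements below `δ`, and `s` is the set of indices at which `G` takes values in `W`. -/
structure IsEndReflection (K : (Fin (n + 1) → Λ) → ι → X) (G : (Fin n → Λ) → ι → X)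
    (s : Set ι) (W : Set X) : Prop where
  mem : ∀ z, StrictMono z → ∀ i, K z i ∈ W
  mem_iff : ∀ x, StrictMono x → ∀ i, G x i ∈ W ↔ i ∈ s
  eq_iff : ∀ x y a, StrictMono x → StrictMono y → (∀ p, x p < a) → (∀ p, y p < a) → ∀ i j,
    K (Fin.snoc (α := fun _ => Λ) x a) i = K (Fin.snoc (α := fun _ => Λ) y a) j ↔ G x i = G y j
  eq_iff_low : ∀ x z a, StrictMono x → StrictMono z → (∀ p, x p < a) → (∀ p, z p < a) → ∀ i j,
    K (Fin.snoc (α := fun _ => Λ) x a) i = K z j ↔ G x i = K z j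
  eq_iff_root : ∀ x y a, StrictMono x → StrictMono y → (∀ p, x p < a) → (∀ p, y p < a) →
    ∀ i, ∀ j ∈ s, K (Fin.snoc (α := fun _ => Λ) x a) i = G y j ↔ G x i = G y j

theorem strictMono_init {z : Fin (n + 1) → Λ} (hz : StrictMono z) :
    StrictMono (fun p : Fin n => z p.castSucc) :=
  fun _ _ h => hz (Fin.castSucc_lt_castSucc_iff.2 h)

variable {K : (Fin (n + 1) → Λ) → ι → X} {G : (Fin n → Λ) → ι → X} {s : Set ι} {W : Set X}

/-- For `i ∈ s` the element `G x i` is an admissible parameter, so the trivial fact `G x i = G x i`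
about `δ` reflects to `a`. -/
theorem IsEndReflection.eq_root (hKG : IsEndReflection K G s W) {x : Fin n → Λ} {a : Λ}
    (hx : StrictMono x) (ha : ∀ p, x p < a) {i : ι} (hi : i ∈ s) :
    K (Fin.snoc (α := fun _ => Λ) x a) i = G x i :=
  (hKG.eq_iff_root x x a hx hx ha ha i i hi).2 rfl

/-- The intersection of two sets of a thinned-out family whose last coordinates differ. -/
theorem IsEndReflection.snoc_eq_snoc_iff (hKG : IsEndReflection K G s W)
    {r : Set (Fin n) → Set ι} (hr : IsRoots r G) {h : Λ → Λ}
    (hh : ∀ ξ, IsNext r G K (h '' Iio ξ) (h ξ)) {x y : Fin n → Λ} {a b : Λ}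
    (hx : StrictMono x) (hy : StrictMono y) (hxa : ∀ p, x p < a) (hyb : ∀ p, y p < b)
    (hab : a < b) (hya : ∀ p, y p ≠ a) (i j : ι) :
    K (h ∘ Fin.snoc (α := fun _ => Λ) x a) i = K (h ∘ Fin.snoc (α := fun _ => Λ) y b) j ↔
      i ∈ s ∧ j ∈ s ∧ G (h ∘ x) i = G (h ∘ y) j := by
  have hm : StrictMono h := fun η ξ hηξ => (hh ξ).lt _ ⟨η, hηξ, rfl⟩
  have hx' := hm.comp hx
  have hy' := hm.comp hy
  have hxa' : ∀ p, (h ∘ x) p < h a := fun p => hm (hxa p)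
  have hyb' : ∀ p, (h ∘ y) p < h b := fun p => hm (hyb p)
  rw [comp_snoc, comp_snoc]
  constructor
  · intro hE
    have hz := strictMono_snoc hx' hxa'
    have hzb : ∀ p, (Fin.snoc (α := fun _ => Λ) (h ∘ x) (h a) : Fin (n + 1) → Λ) p < h b := by
      intro p
      induction p using Fin.lastCases with
      | last => simpa using hm hab
      | cast p => simpa using (hxa' p).trans (hm hab)
    -- The larger last coordinate is replaced by `δ`: the element on the other side is given by
    -- points below `h b`.
    have h1 := (hKG.eq_iff_low _ _ _ hy' hz hyb' hzb j i).1 hE.symm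
    have hj : j ∈ s := (hKG.mem_iff _ hy' j).1 (h1 ▸ hKG.mem _ hz i)
    obtain ⟨c, hc, hcy⟩ := exists_forall_lt_iff_val_lt hy a
    -- The element depends only on the entries of `y` below `a`. Otherwise the least `d` with `j ∈ r
    -- (low n d)` exceeds `c`, and the entry of `y` at position `d - 1` lies above `a`. When that
    -- entry was chosen, coincidence with an element given by earlier points was excluded.
    have hroot : j ∈ r (low n c) := by
      by_contra hjc
      have hex : ∃ d, j ∈ r (low n d) := ⟨n, by
        have := ((hr.eq_iff _ _ hy' hy' (fun p q hpq => hy'.injective hpq) j j).1 rfl).2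
        exact hr.mono (fun p _ => p.2) this⟩
      classical
      have hspec := Nat.find_spec hex
      have hlt : c < Nat.find hex := by
        by_contra! hle
        exact hjc (hr.mono (fun p hp => lt_of_lt_of_le hp hle) hspec)
      have hle : Nat.find hex ≤ n := by
        by_contra! hn
        exact Nat.find_min hex hn (hr.mono (fun p _ => p.2) hspec)
      let l : Fin n := ⟨Nat.find hex - 1, by omega⟩
      have hal : a < y l := by
        have : ¬ y l < a := fun h' => by
          have := (hcy l).1 h'
          simp only [l] at this
          omega
        exact lt_of_le_of_ne (not_lt.1 this) (hya l).symm
      refine (hh (y l)).ne (Fin.snoc (α := fun _ => Λ) (h ∘ x) (h a)) ?_ (h ∘ y) hy' l rfl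
        (fun p hp => ⟨y p, hy hp, rfl⟩) i j (Nat.find_min hex (show Nat.find hex - 1 < _ by omega))
        ?_ h1
      · intro p
        induction p using Fin.lastCases with
        | last => exact ⟨a, hal, by simp⟩
        | cast p => exact ⟨x p, (hxa p).trans hal, by simp⟩
      · show j ∈ r (low n (Nat.find hex - 1 + 1))
        rwa [Nat.sub_add_cancel (by omega)]
    -- The entries of `y` above `a` are moved into the room reserved below `h a`, without changing
    -- the element at `j`. Now everything lies below `h a`, and the fact transfers from `h a` to
    -- `δ`.
    obtain ⟨t, ht, ht1, ht2⟩ := (hh a).room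
    have hlt : ∀ p q : Fin n, p.1 < c → (h ∘ y) p < t q := fun p q hp =>
      ht1 _ ⟨y p, (hcy p).2 hp, rfl⟩ q
    have hne : ∀ p q : Fin n, c ≤ p.1 → (h ∘ y) p ≠ t q := fun p q hp => by
      have : a ≤ y p := by
        by_contra! h'
        exact absurd ((hcy p).1 h') (by omega)
      exact ((ht2 q).trans_le (hm.monotone this)).ne'
    have hsp := hr.splice_eq hy' ht hlt hne hroot
    have hy1 := strictMono_splice hy' ht hlt
    have hy1a : ∀ p, splice (h ∘ y) t c p < h a := by
      intro p
      unfold splice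
      split_ifs with h'
      · exact hm ((hcy p).2 h')
      · exact ht2 p
    have hG : G (h ∘ x) i = G (h ∘ y) j := by
      rw [← hsp]
      refine (hKG.eq_iff_root _ _ _ hx' hy1 hxa' hy1a i j hj).1 ?_
      rw [hsp, h1]
    exact ⟨(hKG.mem_iff _ hx' i).1 (hG ▸ (hKG.mem_iff _ hy' j).2 hj), hj, hG⟩
  · rintro ⟨hi, hj, hG⟩
    rw [hKG.eq_root hx' hxa' hi, hKG.eq_root hy' hyb' hj, hG]

/-- The step from dimension `n` to dimension `n + 1`. -/
theorem IsEndReflection.exists_thinning (hKG : IsEndReflection K G s W) [WellFoundedLT Λ]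
    (hΛ : IsInitial Λ lam) (hlam : lam.IsRegular) (hlam' : ℵ₀ < lam) (hι : #ι < lam)
    {r : Set (Fin n) → Set ι} (hr : IsRoots r G) (hG : ShiftInvariant G) :
    ∃ h : Λ → Λ, StrictMono h ∧ (∃ r', IsRoots r' fun z => K (h ∘ z)) ∧
      ShiftInvariant fun z => K (h ∘ z) := by
  obtain ⟨h, hh⟩ := exists_seq_of_forall_small hΛ.mk_Iio_lt (IsNext r G K)
    (hr.exists_isNext hΛ hlam hlam' hι K)
  have hm : StrictMono h := fun η ξ hηξ => (hh ξ).lt _ ⟨η, hηξ, rfl⟩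
  have hlt : ∀ z : Fin (n + 1) → Λ, StrictMono z → ∀ p : Fin n, z p.castSucc < z (Fin.last n) :=
    fun z hz p => hz (Fin.castSucc_lt_last p)
  have hlast : ∀ z z' : Fin (n + 1) → Λ, StrictMono z → StrictMono z' →
      z (Fin.last n) = z' (Fin.last n) → ∀ i j, K (h ∘ z) i = K (h ∘ z') j ↔
        G (h ∘ fun p : Fin n => z p.castSucc) i = G (h ∘ fun p : Fin n => z' p.castSucc) j := by
    intro z z' hz hz' hab i j
    conv_lhs => rw [← snoc_castSucc_last z, ← snoc_castSucc_last z', ← hab, comp_snoc, comp_snoc]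
    exact hKG.eq_iff _ _ _ (hm.comp (strictMono_init hz)) (hm.comp (strictMono_init hz'))
      (fun p => hm (hlt z hz p)) (fun p => hm (hab ▸ hlt z' hz' p)) i j
  have hdiff : ∀ z z' : Fin (n + 1) → Λ, StrictMono z → StrictMono z' →
      z (Fin.last n) ≠ z' (Fin.last n) → (∀ p : Fin n, z' p.castSucc ≠ z (Fin.last n)) →
      (∀ p : Fin n, z p.castSucc ≠ z' (Fin.last n)) → ∀ i j, K (h ∘ z) i = K (h ∘ z') j ↔
        i ∈ s ∧ j ∈ s ∧
        G (h ∘ fun p : Fin n => z p.castSucc) i = G (h ∘ fun p : Fin n => z' p.castSucc) j := by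
    intro z z' hz hz' hab h1 h2 i j
    conv_lhs => rw [← snoc_castSucc_last z, ← snoc_castSucc_last z']
    rcases lt_or_gt_of_ne hab with hab | hab
    · exact hKG.snoc_eq_snoc_iff hr hh (strictMono_init hz) (strictMono_init hz') (hlt z hz)
        (hlt z' hz') hab h1 i j
    · rw [eq_comm, hKG.snoc_eq_snoc_iff hr hh (strictMono_init hz') (strictMono_init hz)
        (hlt z' hz') (hlt z hz) hab h2 j i,
        eq_comm (a := G (h ∘ fun p : Fin n => z' p.castSucc) j)]
      tauto
  -- If the last coordinate is shared, the root is that of `G`; if not, only indices in `s` survive.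
  -- As `s` does not depend on `m`, the intersection law reduces to distributivity.
  refine ⟨h, hm, ⟨fun m => {i | i ∈ r {p | p.castSucc ∈ m} ∧ (Fin.last n ∈ m ∨ i ∈ s)},
    ⟨?_, ?_⟩⟩, ?_⟩
  · intro z z' hz hz' hal i j
    have hx := strictMono_init hz
    have hy := strictMono_init hz'
    have hxy : TupleAligned (h ∘ fun p : Fin n => z p.castSucc)
        (h ∘ fun p : Fin n => z' p.castSucc) := fun p q hpq =>
      Fin.castSucc_injective _ (hal _ _ (hm.injective hpq))
    have hroot : {p : Fin n | p.castSucc ∈ {p | z p = z' p}} =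
        {p | (h ∘ fun p : Fin n => z p.castSucc) p = (h ∘ fun p : Fin n => z' p.castSucc) p} := by
      ext p
      exact hm.injective.eq_iff.symm
    have hG' := hr.eq_iff _ _ (hm.comp hx) (hm.comp hy) hxy i j
    show K (h ∘ z) i = K (h ∘ z') j ↔ i = j ∧ i ∈ r {p : Fin n | p.castSucc ∈ {p | z p = z' p}} ∧
      (z (Fin.last n) = z' (Fin.last n) ∨ i ∈ s)
    rw [hroot]
    by_cases hab : z (Fin.last n) = z' (Fin.last n)
    · rw [hlast _ _ hz hz' hab, hG']
      simp [hab]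
    · rw [hdiff _ _ hz hz' hab
        (fun p hp => (Fin.castSucc_lt_last p).ne (hal _ _ hp.symm).symm)
        (fun p hp => (Fin.castSucc_lt_last p).ne (hal _ _ hp)), hG']
      simp only [hab, false_or]
      constructor
      · rintro ⟨h1, -, rfl, h3⟩
        exact ⟨rfl, h3, h1⟩
      · rintro ⟨rfl, h3, h1⟩
        exact ⟨h1, h1, rfl, h3⟩
  · intro m m'
    ext i
    show i ∈ r ({p : Fin n | p.castSucc ∈ m} ∩ {p | p.castSucc ∈ m'}) ∧
      ((Fin.last n ∈ m ∧ Fin.last n ∈ m') ∨ i ∈ s) ↔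
      (i ∈ r {p : Fin n | p.castSucc ∈ m} ∧ (Fin.last n ∈ m ∨ i ∈ s)) ∧
      (i ∈ r {p : Fin n | p.castSucc ∈ m'} ∧ (Fin.last n ∈ m' ∨ i ∈ s))
    rw [hr.inter, mem_inter_iff]
    tauto
  · intro z z' hz hz' m hal hzm α hα hα' i j
    have hx := strictMono_init hz
    have hy := strictMono_init hz'
    have hx1 := strictMono_init hα
    have hy1 := strictMono_init hα'
    show K (h ∘ z) i = K (h ∘ z') j ↔
      K (h ∘ Function.update z m α) i = K (h ∘ Function.update z' m α) j
    induction m using Fin.lastCases with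
    | last =>
      have e1 : (fun p : Fin n => Function.update z (Fin.last n) α p.castSucc) =
          fun p : Fin n => z p.castSucc := by
        funext p
        simp
      have e2 : (fun p : Fin n => Function.update z' (Fin.last n) α p.castSucc) =
          fun p : Fin n => z' p.castSucc := by
        funext p
        simp
      rw [hlast _ _ hz hz' hzm, hlast _ _ hα hα' (by simp), e1, e2]
    | cast m =>
      have hu : ∀ w : Fin (n + 1) → Λ, (fun p : Fin n => Function.update w m.castSucc α p.castSucc)
          = Function.update (fun p : Fin n => w p.castSucc) m α := by
        intro w
        funext p
        by_cases hp : p = m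
        · subst hp; simp
        · rw [Function.update_of_ne hp, Function.update_of_ne (by simpa using hp)]
      have hl : ∀ w : Fin (n + 1) → Λ,
          Function.update w m.castSucc α (Fin.last n) = w (Fin.last n) := fun w =>
        Function.update_of_ne (Fin.castSucc_lt_last m).ne' _ _
      have hcomp : ∀ w : Fin n → Λ,
          Function.update (h ∘ w) m (h α) = h ∘ Function.update w m α := fun w =>
        (Function.comp_update h w m α).symm
      have hGs : G (h ∘ fun p : Fin n => z p.castSucc) i = G (h ∘ fun p : Fin n => z' p.castSucc) j ↔
          G (h ∘ fun p : Fin n => Function.update z m.castSucc α p.castSucc) i =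
            G (h ∘ fun p : Fin n => Function.update z' m.castSucc α p.castSucc) j := by
        rw [hu, hu, ← hcomp, ← hcomp]
        refine hG _ _ (hm.comp hx) (hm.comp hy) m ?_ (congrArg h hzm) (h α) ?_ ?_ i j
        · intro p q hp hq hpq
          exact Fin.castSucc_injective _ (hal _ _ (Fin.castSucc_le_castSucc_iff.2 hp)
            (Fin.castSucc_le_castSucc_iff.2 hq) (hm.injective hpq))
        · rw [hcomp, ← hu]
          exact hm.comp hx1
        · rw [hcomp, ← hu]
          exact hm.comp hy1
      by_cases hab : z (Fin.last n) = z' (Fin.last n)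
      · rw [hlast _ _ hz hz' hab, hlast _ _ hα hα' (by rw [hl, hl, hab]), hGs]
      · have hne : ∀ w w' : Fin (n + 1) → Λ, StrictMono w → StrictMono w' →
            w m.castSucc = w' m.castSucc →
            (∀ p q, m.castSucc ≤ p → m.castSucc ≤ q → w p = w' q → p = q) →
            ∀ p : Fin n, w' p.castSucc ≠ w (Fin.last n) := by
          intro w w' hw hw' hmm hal' p hp
          rcases le_or_gt m p with hmp | hmp
          · exact (Fin.castSucc_lt_last p).ne' (hal' _ _ (Fin.castSucc_lt_last m).le
              (Fin.castSucc_le_castSucc_iff.2 hmp) hp.symm)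
          · have h1 := hw (Fin.castSucc_lt_last m)
            have h2 := hw' (Fin.castSucc_lt_castSucc_iff.2 hmp)
            rw [hp, ← hmm] at h2
            exact (h1.trans h2).false
        have hal' : ∀ p q, m.castSucc ≤ p → m.castSucc ≤ q →
            Function.update z m.castSucc α p = Function.update z' m.castSucc α q → p = q := by
          intro p q hp hq hpq
          by_cases hpm : p = m.castSucc
          · subst hpm
            exact hα'.injective (Eq.trans (by simp) hpq)
          · by_cases hqm : q = m.castSucc
            · subst hqm
              exact hα.injective (hpq.trans (by simp))
            · rw [Function.update_of_ne hpm, Function.update_of_ne hqm] at hpq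
              exact hal _ _ hp hq hpq
        have h1 := hne z z' hz hz' hzm hal
        have h2 := hne z' z hz' hz hzm.symm fun p q hp hq hpq => (hal q p hq hp hpq.symm).symm
        have h3 := hne _ _ hα hα' (by simp) hal'
        have h4 := hne _ _ hα' hα (by simp) fun p q hp hq hpq => (hal' q p hq hp hpq.symm).symm
        rw [hdiff _ _ hz hz' hab h1 h2, hdiff _ _ hα hα' (by rwa [hl, hl]) h3 h4, hGs]

end EndExtension

/-! ### The induction statement and dimension one -/

/-- Every colouring and every family of indexed sets on the increasing `n`-tuples of `L` are
homogeneous along some copy of `Λ`. The index set may depend on the colour. -/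
def HasDeltaSystems (n : ℕ) (L Λ : Type u) [LinearOrder L] [LinearOrder Λ]
    (lam : Cardinal.{u}) : Prop :=
  ∀ (C : Type u) (ι : C → Type u) (X : Type u) (g : (Fin n → L) → C)
    (F : ∀ k, (Fin n → L) → ι k → X), #C < lam → (∀ k, ∀ θ < lam, θ ^ #(ι k) < lam) →
    (∀ x, StrictMono x → Function.Injective (F (g x) x)) →
    ∃ k, ∃ h : Λ → L, StrictMono h ∧ (∀ x, StrictMono x → g (h ∘ x) = k) ∧
      (∃ r, IsRoots r fun x => F k (h ∘ x)) ∧ ShiftInvariant fun x => F k (h ∘ x)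

theorem lt_of_power_lt {lam κ : Cardinal.{u}} (hlam : ℵ₀ < lam) (h : ∀ θ < lam, θ ^ κ < lam) :
    κ < lam :=
  (cantor κ).trans (h 2 ((by exact_mod_cast natCast_lt_aleph0 (n := 2) : (2 : Cardinal) < ℵ₀).trans
    hlam))

section OneDimensional

variable {L Λ : Type u} [LinearOrder L] [LinearOrder Λ]
  {lam : Cardinal.{u}} {ι X : Type u}

/-- The elements of the sets indexed by points below `γ`. -/
def earlier (v : L → ι → X) (γ : L) : Set X := {w | ∃ a < γ, ∃ i, v a i = w}

/-- The part of the set indexed by `β` among the elements of earlier sets, with positions. -/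
def earlierTrace (v : L → ι → X) (γ β : L) : Set (ι × X) :=
  {q | q.2 ∈ earlier v γ ∧ v β q.1 = q.2}

theorem earlier_mono (v : L → ι → X) {γ γ' : L} (h : γ ≤ γ') : earlier v γ ⊆ earlier v γ' := by
  rintro w ⟨a, ha, i, rfl⟩
  exact ⟨a, ha.trans_le h, i, rfl⟩

/-- A trace is coded by a function from `ι` to the earlier elements plus one extra value for a new
element. The inaccessibility hypothesis bounds the number of such functions. -/
theorem mk_range_earlierTrace_lt (hL : IsInitial L lam) (hlam : ℵ₀ < lam)
    (hι : ∀ θ < lam, θ ^ #ι < lam) (v : L → ι → X) (γ : L) :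
    #(range (earlierTrace v γ)) < lam := by
  have hE : #(earlier v γ) < lam := by
    have h1 : earlier v γ ⊆ range fun q : Iio γ × ι => v q.1 q.2 := by
      rintro w ⟨a, ha, i, rfl⟩
      exact ⟨(⟨a, ha⟩, i), rfl⟩
    refine ((mk_le_mk_of_subset h1).trans mk_range_le).trans_lt ?_
    rw [mk_prod, Cardinal.lift_id, Cardinal.lift_id]
    exact mul_lt_of_lt hlam.le (hL.mk_Iio_lt γ) (lt_of_power_lt hlam hι)
  have h2 : range (earlierTrace v γ) ⊆ range fun (f : ι → Option (earlier v γ)) =>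
      {q : ι × X | ∃ h : q.2 ∈ earlier v γ, f q.1 = some ⟨q.2, h⟩} := by
    classical
    rintro _ ⟨β, rfl⟩
    refine ⟨fun i => if h : v β i ∈ earlier v γ then some ⟨v β i, h⟩ else none, ?_⟩
    ext ⟨i, w⟩
    constructor
    · rintro ⟨h, hf⟩
      simp only at h hf
      split_ifs at hf with h'
      simp only [Option.some.injEq, Subtype.mk.injEq] at hf
      exact ⟨h, hf⟩
    · rintro ⟨h, hf⟩
      simp only at h hf
      subst hf
      exact ⟨h, by simp [h]⟩
  refine ((mk_le_mk_of_subset h2).trans mk_range_le).trans_lt ?_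
  rw [← power_def, mk_option]
  exact hι _ (add_lt_of_lt hlam.le hE (one_lt_aleph0.trans hlam))

/-- The Δ-system lemma for sets indexed by a common index set. -/
theorem IsInitial.exists_deltaSystem [WellFoundedLT L] [WellFoundedLT Λ] (hL : IsInitial L lam) (hΛ : IsInitial Λ lam)
    (hlam : lam.IsRegular) (hlam' : ℵ₀ < lam) (hι : ∀ θ < lam, θ ^ #ι < lam)
    (v : L → ι → X) (hv : ∀ a, Function.Injective (v a)) :
    ∃ e : Λ → L, StrictMono e ∧ ∃ s : Set ι, ∀ ξ η, ξ ≠ η → ∀ i j,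
      v (e ξ) i = v (e η) j ↔ i = j ∧ i ∈ s := by
  -- Cofinality above `#ι` makes the trace of the set at a closure point `δ` settle before `δ`.
  obtain ⟨χ, hχ, hιχ, hχl⟩ : ∃ χ : Cardinal.{u}, χ.IsRegular ∧ #ι < χ ∧ χ < lam := by
    rcases lt_or_ge #ι ℵ₀ with h | h
    · exact ⟨ℵ₀, isRegular_aleph0, h, hlam'⟩
    · refine ⟨Order.succ #ι, isRegular_succ h, Order.lt_succ _, ?_⟩
      refine (Order.succ_le_of_lt (cantor #ι)).trans_lt (hι 2 ?_)
      exact (by exact_mod_cast natCast_lt_aleph0 (n := 2) : (2 : Cardinal) < ℵ₀).trans hlam'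
  -- A pressing-down argument. If no trace recurred, every `t` and `γ` would have a stage `b t γ`
  -- past `γ` at which no later point has trace `t`. A point `δ` closed under these stages
  -- contradicts this for its own settled trace.
  obtain ⟨t, γ₀, ht⟩ : ∃ t γ₀, ∀ γ, γ₀ ≤ γ → ∃ β, γ ≤ β ∧ earlierTrace v γ β = t := by
    by_contra! hno
    choose b hb hb' using hno
    have hf : ∀ γ, ∃ γ', ∀ β, b (earlierTrace v γ β) γ < γ' := by
      intro γ
      obtain ⟨γ', h⟩ := hL.exists_forall_lt hlam ((fun t => b t γ) '' range (earlierTrace v γ))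
        (mk_image_le.trans_lt (mk_range_earlierTrace_lt hL hlam' hι v γ))
      exact ⟨γ', fun β => h _ ⟨_, ⟨β, rfl⟩, rfl⟩⟩
    choose f hf using hf
    obtain ⟨δ, hδ, ⟨γ₁, hγ₁⟩, hδ'⟩ := hL.exists_closed_point hlam hχ hχl f
    have hex : ∀ i, ∃ γ < δ, v δ i ∈ earlier v δ → v δ i ∈ earlier v γ := by
      intro i
      by_cases h : v δ i ∈ earlier v δ
      · obtain ⟨a, ha, i', hi'⟩ := h
        obtain ⟨γ, hγ, haγ⟩ := hδ' {a} (by simpa using ha)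
          (by simpa using one_lt_aleph0.trans_le hχ.aleph0_le)
        exact ⟨γ, hγ, fun _ => ⟨a, haγ a rfl, i', hi'⟩⟩
      · exact ⟨γ₁, hγ₁, fun h' => (h h').elim⟩
    choose p hp hp' using hex
    obtain ⟨γ, hγ, hpγ⟩ := hδ' (range p) (by rintro _ ⟨i, rfl⟩; exact hp i)
      (mk_range_le.trans_lt hιχ)
    have htr : ∀ γ', γ ≤ γ' → γ' ≤ δ → earlierTrace v γ' δ = earlierTrace v γ δ := by
      intro γ' h1 h2
      ext ⟨i, w⟩
      refine ⟨?_, fun h => ⟨earlier_mono v h1 h.1, h.2⟩⟩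
      rintro ⟨hw, hi⟩
      simp only at hw hi
      subst hi
      exact ⟨earlier_mono v (hpγ _ ⟨i, rfl⟩).le (hp' i (earlier_mono v h2 hw)), rfl⟩
    have hbδ := (hf γ δ).trans (hδ γ hγ)
    exact hb' (earlierTrace v γ δ) γ δ hbδ.le (htr _ (hb _ _) hbδ.le)
  obtain ⟨e, he⟩ := exists_seq_of_forall_small hΛ.mk_Iio_lt
    (fun (S : Set L) y => ∃ γ, (∀ s ∈ S, s < γ) ∧ γ ≤ y ∧ earlierTrace v γ y = t) (by
      intro S hS
      obtain ⟨b, hb⟩ := hL.exists_forall_lt hlam S hS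
      obtain ⟨y, hy, hty⟩ := ht (max b γ₀) (le_max_right _ _)
      exact ⟨y, _, fun s hs => (hb s hs).trans_le (le_max_left _ _), hy, hty⟩)
  choose γ hγ hγe htr using he
  have hm : StrictMono e := fun η ξ h => (hγ ξ _ ⟨η, h, rfl⟩).trans_le (hγe ξ)
  have hmem : ∀ {ξ i w}, (i, w) ∈ t → v (e ξ) i = w := fun {ξ i w} h => by
    rw [← htr ξ] at h
    exact h.2
  -- An element shared with an earlier set is recorded in `t`, and `t` fixes its position in every
  -- set of the sequence.
  have key : ∀ η ξ, η < ξ → ∀ i j, v (e ξ) i = v (e η) j → i = j ∧ ∃ w, (i, w) ∈ t := by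
    intro η ξ h i j hij
    have h1 : (i, v (e η) j) ∈ t := by
      rw [← htr ξ]
      exact ⟨⟨e η, hγ ξ _ ⟨η, h, rfl⟩, j, rfl⟩, hij⟩
    exact ⟨hv _ (hmem h1), _, h1⟩
  refine ⟨e, hm, {i | ∃ w, (i, w) ∈ t}, fun ξ η hne i j => ⟨fun h => ?_, ?_⟩⟩
  · rcases lt_or_gt_of_ne hne with h' | h'
    · obtain ⟨rfl, h2⟩ := key ξ η h' j i h.symm
      exact ⟨rfl, h2⟩
    · exact key η ξ h' i j h
  · rintro ⟨rfl, w, hw⟩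
    rw [hmem hw, hmem hw]

theorem hasDeltaSystems_one [WellFoundedLT L] [WellFoundedLT Λ] (hL : IsInitial L lam) (hΛ : IsInitial Λ lam)
    (hlam : lam.IsRegular) (hlam' : ℵ₀ < lam) : HasDeltaSystems 1 L Λ lam := by
  intro C ι X g F hC hι hF
  obtain ⟨k, hk⟩ := infinite_pigeonhole_card (fun a : L => g fun _ => a) lam hL.mk_eq.ge
    hlam.aleph0_le (by rwa [hlam.cof_ord])
  have hL₀ : IsInitial ((fun a : L => g fun _ => a) ⁻¹' {k}) lam := by
    refine ⟨le_antisymm ((mk_set_le _).trans hL.mk_eq.le) hk, fun a => ?_⟩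
    refine (mk_le_of_injective (f := fun b : Iio a => (⟨b.1.1, b.2⟩ : Iio a.1)) ?_).trans_lt
      (hL.mk_Iio_lt a.1)
    intro b c h
    exact Subtype.ext (Subtype.ext (congrArg (fun q : Iio a.1 => q.1) h))
  have hsub : ∀ x : Fin 1 → L, StrictMono x := fun x p q h => absurd h (by
    rw [Subsingleton.elim p q]; exact lt_irrefl _)
  have hsub' : ∀ x : Fin 1 → Λ, x = fun _ => x 0 := fun x => by
    funext p
    rw [Subsingleton.elim p 0]
  have hgk : ∀ a : ((fun a : L => g fun _ => a) ⁻¹' {k}), g (fun _ => a.1) = k := fun a => a.2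
  have hinj : ∀ a : ((fun a : L => g fun _ => a) ⁻¹' {k}),
      Function.Injective (F k fun _ => a.1) := fun a => by
    have := hF (fun _ => a.1) (hsub _)
    rwa [hgk a] at this
  obtain ⟨e, he, s, hs⟩ := hL₀.exists_deltaSystem hΛ hlam hlam' (hι k)
    (fun a => F k fun _ => a.1) hinj
  refine ⟨k, fun ξ => (e ξ).1, fun _ _ h => he h, ?_, ⟨fun m => {i | 0 ∈ m ∨ i ∈ s}, ?_, ?_⟩, ?_⟩
  · intro x _
    rw [hsub' x]
    exact hgk _
  · intro x y _ _ _ i j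
    rw [hsub' x, hsub' y]
    by_cases h : x 0 = y 0
    · rw [h]
      exact ⟨fun h' => ⟨hinj _ h', Or.inl rfl⟩, fun h' => by rw [h'.1]⟩
    · refine (hs _ _ h i j).trans (and_congr_right fun _ => ?_)
      simp [h]
  · intro m m'
    ext i
    show (0 ∈ m ∧ 0 ∈ m') ∨ i ∈ s ↔ (0 ∈ m ∨ i ∈ s) ∧ (0 ∈ m' ∨ i ∈ s)
    tauto
  -- One-entry tuples with a common entry coincide, so both sides reduce to `i = j`.
  · intro x y _ _ m _ hxy α _ _ i j
    rw [Subsingleton.elim m 0] at hxy ⊢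
    rw [hsub' x, hsub' y, hxy, hsub' (Function.update _ _ _)]
    exact ⟨fun h => by rw [hinj _ h], fun h => by rw [hinj _ h]⟩

end OneDimensional

/-! ### End-homogeneous sequences -/

section Reflection

variable {n : ℕ} {L : Type u} {C D X : Type u}

/-- The tuples with entries in `A`. -/
def tuplesIn (n : ℕ) (A : Set L) : Set (Fin n → L) := {x | ∀ p, x p ∈ A}

/-- The elements of the sets indexed by tuples from `A`. -/
def elementsOf (Φ : (Fin n → L) → D → X) (A : Set L) : Set X :=
  {w | ∃ z ∈ tuplesIn n A, ∃ d, Φ z d = w}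

/-- Statements about a point `β`: the colour of `(x, β)`, the equality of an indexed element of
the set at `(x, β)` with a given one, and the equality of elements at `(x, β)` and `(y, β)`. -/
abbrev Facts (n : ℕ) (L C D X : Type u) : Type u :=
  ((Fin n → L) × C) ⊕ (((Fin n → L) × D × X) ⊕ (((Fin n → L) × D) × ((Fin n → L) × D)))

/-- The statements with parameters from `A` and `E`. -/
def factsOver (n : ℕ) (C D : Type u) (A : Set L) (E : Set X) : Set (Facts n L C D X) :=
  Sum.inl '' (tuplesIn n A ×ˢ Set.univ) ∪
    (Sum.inr '' (Sum.inl '' (tuplesIn n A ×ˢ (Set.univ ×ˢ E))) ∪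
      Sum.inr '' (Sum.inr '' ((tuplesIn n A ×ˢ Set.univ) ×ˢ (tuplesIn n A ×ˢ Set.univ))))

/-- The statements that hold at `β`. -/
def factsAt (g : (Fin (n + 1) → L) → C) (Φ : (Fin (n + 1) → L) → D → X) (β : L) :
    Set (Facts n L C D X) :=
  {f | Sum.elim (fun q => g (Fin.snoc (α := fun _ => L) q.1 β) = q.2)
    (Sum.elim (fun q => Φ (Fin.snoc (α := fun _ => L) q.1 β) q.2.1 = q.2.2)
      fun q => Φ (Fin.snoc (α := fun _ => L) q.1.1 β) q.1.2 =
        Φ (Fin.snoc (α := fun _ => L) q.2.1 β) q.2.2) f}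

variable {d : Cardinal.{u}}

theorem mk_tuplesIn_le (hd : ℵ₀ ≤ d) {A : Set L} (hA : #A ≤ d) (n : ℕ) :
    #(tuplesIn n A) ≤ d := by
  have h : tuplesIn n A ⊆ range fun x : Fin n → A => fun p => (x p).1 := fun x hx =>
    ⟨fun p => ⟨x p, hx p⟩, rfl⟩
  refine ((mk_le_mk_of_subset h).trans mk_range_le).trans ?_
  have : #(Fin n → A) = #A ^ n := by simp
  rw [this]
  exact power_nat_le_max.trans (max_le hA hd)

theorem mk_elementsOf_le (hd : ℵ₀ ≤ d) {A : Set L} (hA : #A ≤ d) (hD : #D ≤ d)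
    (Φ : (Fin n → L) → D → X) : #(elementsOf Φ A) ≤ d := by
  have h : elementsOf Φ A ⊆ range fun q : tuplesIn n A × D => Φ q.1.1 q.2 := by
    rintro w ⟨z, hz, i, rfl⟩
    exact ⟨(⟨z, hz⟩, i), rfl⟩
  refine ((mk_le_mk_of_subset h).trans mk_range_le).trans ?_
  rw [mk_prod, Cardinal.lift_id, Cardinal.lift_id]
  exact mul_le_of_le hd (mk_tuplesIn_le hd hA n) hD

theorem mk_factsOver_le (hd : ℵ₀ ≤ d) {A : Set L} (hA : #A ≤ d) {E : Set X} (hE : #E ≤ d)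
    (hC : #C ≤ d) (hD : #D ≤ d) (n : ℕ) : #(factsOver n C D A E) ≤ d := by
  have ht := mk_tuplesIn_le hd hA n
  have hprod : ∀ {α β : Type u} {s : Set α} {t : Set β}, #s ≤ d → #t ≤ d →
      #(s ×ˢ t : Set (α × β)) ≤ d := by
    intro α β s t hs ht
    rw [mk_congr (Equiv.Set.prod s t), mk_prod, Cardinal.lift_id, Cardinal.lift_id]
    exact mul_le_of_le hd hs ht
  have hC' : #(Set.univ : Set C) ≤ d := by rwa [mk_univ]
  have hD' : #(Set.univ : Set D) ≤ d := by rwa [mk_univ]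
  refine (mk_union_le _ _).trans (add_le_of_le hd (mk_image_le.trans (hprod ht hC')) ?_)
  refine (mk_union_le _ _).trans (add_le_of_le hd ?_ ?_)
  · exact mk_image_le.trans (mk_image_le.trans (hprod ht (hprod hD' hE)))
  · exact mk_image_le.trans (mk_image_le.trans (hprod (hprod ht hD') (hprod ht hD')))

theorem tuplesIn_mono {A B : Set L} (h : A ⊆ B) : tuplesIn n A ⊆ tuplesIn n B :=
  fun _ hx p => h (hx p)

theorem elementsOf_mono {A B : Set L} (h : A ⊆ B) (Φ : (Fin n → L) → D → X) :
    elementsOf Φ A ⊆ elementsOf Φ B := by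
  rintro w ⟨z, hz, i, rfl⟩
  exact ⟨z, tuplesIn_mono h hz, i, rfl⟩

theorem factsOver_mono {A B : Set L} (h : A ⊆ B) {E E' : Set X} (hE : E ⊆ E') :
    factsOver n C D A E ⊆ factsOver n C D B E' := by
  have ht : tuplesIn n A ⊆ tuplesIn n B := tuplesIn_mono h
  unfold factsOver
  gcongr

/-- A fact mentions at most one element, so each single fact has its parameters bounded below `δ`,
as reflection requires. -/
theorem exists_mem_factsOver_of_elements {A : Set L} {E : Set X} {f : Facts n L C D X}
    (hf : f ∈ factsOver n C D A E) : ∃ E' ⊆ E, E'.Subsingleton ∧ f ∈ factsOver n C D A E' := by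
  rcases hf with ⟨q, hq, rfl⟩ | ⟨_, ⟨q, hq, rfl⟩, rfl⟩ | ⟨_, ⟨q, hq, rfl⟩, rfl⟩
  · exact ⟨∅, empty_subset _, subsingleton_empty, Or.inl ⟨q, hq, rfl⟩⟩
  · exact ⟨{q.2.2}, singleton_subset_iff.2 hq.2.2, subsingleton_singleton,
      Or.inr (Or.inl ⟨_, ⟨q, ⟨hq.1, hq.2.1, rfl⟩, rfl⟩, rfl⟩)⟩
  · exact ⟨∅, empty_subset _, subsingleton_empty, Or.inr (Or.inr ⟨_, ⟨q, hq, rfl⟩, rfl⟩)⟩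

variable [LinearOrder L] [WellFoundedLT L]

/-- A sequence of points below some `δ`, each of which behaves over the earlier ones like `δ`. -/
theorem IsInitial.exists_end_homogeneous {L' : Type u} [LinearOrder L'] [WellFoundedLT L']
    {τ : Cardinal.{u}} (hτ : τ.IsRegular) (hτ' : ℵ₀ < τ) (hL : IsInitial L (Order.succ (2 ^< τ)))
    (hL' : IsInitial L' τ) (hC : #C < τ) (hD : #D < τ) (g : (Fin (n + 1) → L) → C)
    (Φ : (Fin (n + 1) → L) → D → X) :
    ∃ (δ : L) (e : L' → L), StrictMono e ∧ (∀ ξ, e ξ < δ) ∧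
      ∀ ξ, ∀ f ∈ factsOver n C D (e '' Iio ξ) (elementsOf Φ (e '' Iio ξ) ∪
        elementsOf (fun y : Fin n → L => Φ (Fin.snoc (α := fun _ => L) y δ)) (e '' Iio ξ) ∩
          elementsOf Φ (Iio δ)),
        f ∈ factsAt g Φ (e ξ) ↔ f ∈ factsAt g Φ δ := by
  have hτθ : τ ≤ 2 ^< τ := le_two_powerlt τ
  have hθ : ℵ₀ ≤ 2 ^< τ := hτ.aleph0_le.trans hτθ
  have hIio : ∀ γ : L, #(Iio γ) ≤ 2 ^< τ := fun γ => Order.lt_succ_iff.1 (hL.mk_Iio_lt γ)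
  obtain ⟨δ, ⟨γ₁, hγ₁⟩, hcof, hrefl⟩ := hL.exists_reflecting hτ hτ' (factsAt g Φ)
    (fun γ => factsOver n C D (Iio γ) (elementsOf Φ (Iio γ)))
    (fun γ γ' h => factsOver_mono (Iio_subset_Iio h) (elementsOf_mono (Iio_subset_Iio h) Φ))
    (fun γ => mk_factsOver_le hθ (hIio γ) (mk_elementsOf_le hθ (hIio γ) (hD.le.trans hτθ) Φ)
      (hC.le.trans hτθ) (hD.le.trans hτθ) n)
  -- The second part admits elements of the sets at `(y, δ)` that already occur below `δ`. They make
  -- it possible to compare the sets at `δ` with those at the points of the sequence.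
  let E : Set L → Set X := fun S => elementsOf Φ S ∪
    elementsOf (fun y : Fin n → L => Φ (Fin.snoc (α := fun _ => L) y δ)) S ∩ elementsOf Φ (Iio δ)
  obtain ⟨e, he⟩ := exists_seq_of_forall_small hL'.mk_Iio_lt
    -- The relation is conditional on `S` lying below `δ`, so that it is satisfiable for every small
    -- `S`; `hlt` removes the condition by induction.
    (fun (S : Set L) y => (∀ s ∈ S, s < δ) → y < δ ∧ (∀ s ∈ S, s < y) ∧
      ∀ f ∈ factsOver n C D S (E S), f ∈ factsAt g Φ y ↔ f ∈ factsAt g Φ δ) (by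
    intro S hS
    by_cases hSδ : ∀ s ∈ S, s < δ
    swap
    · exact ⟨δ, fun h => (hSδ h).elim⟩
    obtain ⟨γ₀, hγ₀, hSγ⟩ := hcof S hSδ hS
    have hEδ : E S ⊆ elementsOf Φ (Iio δ) :=
      union_subset (elementsOf_mono hSδ Φ) inter_subset_right
    have hdlt : max (max ℵ₀ #S) (max #C #D) < τ := max_lt (max_lt hτ' hS) (max_lt hC hD)
    have hcard : #(factsOver n C D S (E S)) < τ := by
      refine lt_of_le_of_lt ?_ hdlt
      have h0 : ℵ₀ ≤ max (max ℵ₀ #S) (max #C #D) := (le_max_left _ _).trans (le_max_left _ _)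
      have hS' : #S ≤ max (max ℵ₀ #S) (max #C #D) := (le_max_right _ _).trans (le_max_left _ _)
      have hC' : #C ≤ max (max ℵ₀ #S) (max #C #D) := (le_max_left _ _).trans (le_max_right _ _)
      have hD' : #D ≤ max (max ℵ₀ #S) (max #C #D) := (le_max_right _ _).trans (le_max_right _ _)
      refine mk_factsOver_le h0 hS' ?_ hC' hD' n
      refine (mk_union_le _ _).trans (add_le_of_le h0 (mk_elementsOf_le h0 hS' hD' Φ) ?_)
      exact (mk_le_mk_of_subset inter_subset_left).trans (mk_elementsOf_le h0 hS' hD' _)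
    obtain ⟨α, hα, hα', hf⟩ := hrefl (factsOver n C D S (E S)) (by
      intro f hf
      obtain ⟨E', hE', hsub, hfE'⟩ := exists_mem_factsOver_of_elements hf
      obtain ⟨γ, hγ, hEγ⟩ : ∃ γ < δ, E' ⊆ elementsOf Φ (Iio γ) := by
        rcases hsub.eq_empty_or_singleton with rfl | ⟨w, rfl⟩
        · exact ⟨γ₁, hγ₁, empty_subset _⟩
        · obtain ⟨z, hz, i, rfl⟩ := hEδ (hE' rfl)
          obtain ⟨γ, hγ, hzγ⟩ := hcof (range z) (by rintro _ ⟨p, rfl⟩; exact hz p)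
            ((finite_range z).lt_aleph0.trans hτ')
          exact ⟨γ, hγ, singleton_subset_iff.2 ⟨z, fun p => hzγ _ ⟨p, rfl⟩, i, rfl⟩⟩
      refine ⟨max γ₀ γ, max_lt hγ₀ hγ, factsOver_mono ?_ ?_ hfE'⟩
      · exact fun s hs => (hSγ s hs).trans_le (le_max_left _ _)
      · exact hEγ.trans (elementsOf_mono (Iio_subset_Iio (le_max_right _ _)) Φ)) hcard γ₀ hγ₀
    exact ⟨α, fun _ => ⟨hα, fun s hs => (hSγ s hs).trans_le hα', hf⟩⟩)
  have hlt : ∀ ξ, e ξ < δ := by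
    intro ξ
    induction ξ using WellFoundedLT.induction with
    | ind ξ ih => exact (he ξ (by rintro _ ⟨η, hη, rfl⟩; exact ih η hη)).1
  have he' := fun ξ => he ξ (by rintro _ ⟨η, hη, rfl⟩; exact hlt η)
  exact ⟨δ, e, fun η ξ h => (he' ξ).2.1 _ ⟨η, h, rfl⟩, hlt, fun ξ => (he' ξ).2.2⟩

end Reflection

/-! ### The induction on the dimension -/

section Step

/-- Having `S` defined for all colours avoids transporting `S a` along `a = k`. -/
theorem sigma_set_eq {C : Type u} {ι : C → Type u} (S : ∀ k, Set (ι k)) {a k : C} {s : Set (ι k)}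
    (h : (⟨a, S a⟩ : Σ k, Set (ι k)) = ⟨k, s⟩) : a = k ∧ S k = s := by
  cases h
  exact ⟨rfl, rfl⟩

theorem HasDeltaSystems.succ {n : ℕ} {L L' Λ : Type u} [LinearOrder L] [WellFoundedLT L]
    [LinearOrder L'] [WellFoundedLT L'] [LinearOrder Λ] [WellFoundedLT Λ] {lam τ : Cardinal.{u}}
    (hτ : τ.IsRegular) (hlamτ : lam ≤ τ) (hL : IsInitial L (Order.succ (2 ^< τ)))
    (hL' : IsInitial L' τ) (hΛ : IsInitial Λ lam) (hlam : lam.IsRegular) (hlam' : ℵ₀ < lam)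
    (ih : HasDeltaSystems n L' Λ lam) : HasDeltaSystems (n + 1) L Λ lam := by
  intro C ι X g F hC hι hF
  have hιlt : ∀ k, #(ι k) < lam := fun k => lt_of_power_lt hlam' (hι k)
  have hD : #(Σ k, ι k) < lam := by
    rw [mk_sigma]
    exact sum_lt_of_isRegular hlam hC hιlt
  obtain ⟨δ, e, he, heδ, hfacts⟩ := hL.exists_end_homogeneous hτ (hlam'.trans_le hlamτ) hL'
    (hC.trans_le hlamτ) (hD.trans_le hlamτ) g (fun z (d : Σ k, ι k) => F d.1 z d.2)
  let Φ : (Fin (n + 1) → L) → (Σ k, ι k) → X := fun z d => F d.1 z d.2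
  let top : (Fin n → L') → Fin (n + 1) → L := fun x => Fin.snoc (α := fun _ => L) (e ∘ x) δ
  have htop : ∀ x, StrictMono x → StrictMono (top x) := fun x hx =>
    strictMono_snoc (he.comp hx) fun p => heδ _
  have htup : ∀ {m : ℕ} {x : Fin m → L'} {a : L'}, (∀ p, x p < a) →
      e ∘ x ∈ tuplesIn m (e '' Iio a) := fun hx p => ⟨_, hx p, rfl⟩
  have hcol : ∀ (x : Fin n → L') (a : L'), (∀ p, x p < a) →
      g (Fin.snoc (α := fun _ => L) (e ∘ x) (e a)) = g (top x) := fun x a hx =>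
    (hfacts a (Sum.inl (e ∘ x, g (top x))) (Or.inl ⟨_, ⟨htup hx, trivial⟩, rfl⟩)).2 rfl
  -- Besides the colour at `(x, δ)`, the new colour records which indices name elements occurring
  -- below `δ`, so homogeneity makes this set a constant `s`. There are still fewer than `lam`
  -- colours, because `2 ^ #(ι k) < lam` and `lam` is regular.
  obtain ⟨⟨k, s⟩, h, hh, hhg, ⟨r, hr⟩, hshift⟩ := ih (Σ k, Set (ι k)) (fun c => ι c.1) X
    (fun x => ⟨g (top x), {i | F (g (top x)) (top x) i ∈ elementsOf Φ (Iio δ)}⟩)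
    (fun c x => F c.1 (top x))
    (by
      rw [mk_sigma]
      refine sum_lt_of_isRegular hlam hC fun k => ?_
      rw [mk_set]
      exact hι k 2 ((by exact_mod_cast natCast_lt_aleph0 (n := 2) : (2 : Cardinal) < ℵ₀).trans
        hlam'))
    (fun c => hι c.1) (fun x hx => hF _ (htop x hx))
  have hks := fun x hx => sigma_set_eq (fun k => {i | F k (top (h ∘ x)) i ∈ elementsOf Φ (Iio δ)})
    (hhg x hx)
  simp only at hr hshift
  have hKG : IsEndReflection (fun z => F k (e ∘ h ∘ z)) (fun x => F k (top (h ∘ x))) s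
      (elementsOf Φ (Iio δ)) := by
    have hsnoc : ∀ (x : Fin n → Λ) (a : Λ), e ∘ h ∘ Fin.snoc (α := fun _ => Λ) x a =
        Fin.snoc (α := fun _ => L) (e ∘ h ∘ x) (e (h a)) := fun x a => by
      rw [comp_snoc, comp_snoc]
    refine ⟨fun z _ i => ⟨_, fun p => heδ _, ⟨k, i⟩, rfl⟩, ?_, ?_, ?_, ?_⟩
    · intro x hx i
      rw [← (hks x hx).2]
      rfl
    · intro x y a _ _ hxa hya i j
      simp only [hsnoc]
      exact hfacts (h a) (Sum.inr (Sum.inr ((e ∘ h ∘ x, ⟨k, i⟩), (e ∘ h ∘ y, ⟨k, j⟩))))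
        (Or.inr (Or.inr ⟨_, ⟨_, ⟨⟨htup fun p => hh (hxa p), trivial⟩,
          ⟨htup fun p => hh (hya p), trivial⟩⟩, rfl⟩, rfl⟩))
    · intro x z a _ _ hxa hza i j
      simp only [hsnoc]
      exact hfacts (h a) (Sum.inr (Sum.inl (e ∘ h ∘ x, ⟨k, i⟩, F k (e ∘ h ∘ z) j)))
        (Or.inr (Or.inl ⟨_, ⟨_, ⟨htup fun p => hh (hxa p), trivial,
          Or.inl ⟨_, htup fun p => hh (hza p), ⟨k, j⟩, rfl⟩⟩, rfl⟩, rfl⟩))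
    · intro x y a _ hy hxa hya i j hj
      simp only [hsnoc]
      have hjW : F k (top (h ∘ y)) j ∈ elementsOf Φ (Iio δ) := by
        rw [← (hks y hy).2] at hj
        exact hj
      exact hfacts (h a) (Sum.inr (Sum.inl (e ∘ h ∘ x, ⟨k, i⟩, F k (top (h ∘ y)) j)))
        (Or.inr (Or.inl ⟨_, ⟨_, ⟨htup fun p => hh (hxa p), trivial,
          Or.inr ⟨⟨_, htup fun p => hh (hya p), ⟨k, j⟩, rfl⟩, hjW⟩⟩, rfl⟩, rfl⟩))
  obtain ⟨h', hh', hroots, hshift'⟩ := hKG.exists_thinning hΛ hlam hlam' (hιlt k) hr hshift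
  refine ⟨k, e ∘ h ∘ h', he.comp (hh.comp hh'), ?_, hroots, hshift'⟩
  intro z hz
  have hz1 := strictMono_init hz
  have : (e ∘ h ∘ h') ∘ z = Fin.snoc (α := fun _ => L)
      (e ∘ h ∘ h' ∘ fun p : Fin n => z p.castSucc) (e (h (h' (z (Fin.last n))))) := by
    rw [← comp_snoc, ← comp_snoc, ← comp_snoc, snoc_castSucc_last]
    rfl
  rw [this]
  refine (hcol _ _ fun p => hh (hh' (hz (Fin.castSucc_lt_last p)))).trans ?_
  exact (hks _ (hh'.comp hz1)).1

theorem isRegular_sigma {lam : Cardinal.{u}} (hlam : lam.IsRegular) (n : ℕ) :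
    (sigma lam (n + 1)).IsRegular ∧ lam ≤ sigma lam (n + 1) := by
  induction n with
  | zero => exact ⟨hlam, le_rfl⟩
  | succ n ih =>
    have h1 : sigma lam (n + 1) ≤ 2 ^< sigma lam (n + 1) := le_two_powerlt _
    exact ⟨isRegular_succ (ih.1.aleph0_le.trans h1), ih.2.trans (h1.trans (Order.le_succ _))⟩

theorem hasDeltaSystems_sigma {lam : Cardinal.{u}} (hlam : lam.IsRegular) (hlam' : ℵ₀ < lam)
    {Λ : Type u} [LinearOrder Λ] [WellFoundedLT Λ] (hΛ : IsInitial Λ lam) (n : ℕ) :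
    ∀ (L : Type u) [LinearOrder L] [WellFoundedLT L], IsInitial L (sigma lam (n + 1)) →
      HasDeltaSystems (n + 1) L Λ lam := by
  induction n with
  | zero => exact fun L _ _ hL => hasDeltaSystems_one hL hΛ hlam hlam'
  | succ n ih =>
    exact fun L _ _ hL => HasDeltaSystems.succ (isRegular_sigma hlam n).1 (isRegular_sigma hlam n).2
      hL (isInitial_toType_ord _) hΛ hlam hlam' (ih _ (isInitial_toType_ord _))

end Step

/-! ### Order types and finite tuples of ordinals -/

section OrderType

theorem nth_otp_inter {a : Set Ordinal.{u}} {γ : Ordinal.{u}} (hγ : γ ∈ a) :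
    otp (a ∩ Iio γ) < otp a ∧ nth a (otp (a ∩ Iio γ)) = γ := by
  have h : otp (a ∩ Iio γ) < otp a := by
    rw [otp_inter_Iio a ⟨γ, hγ⟩]
    exact Ordinal.typein_lt_type _ _
  exact ⟨h, nth_unique (nth_spec h).1 hγ (nth_spec h).2⟩

theorem nth_injOn {a : Set Ordinal.{u}} {i j : Ordinal.{u + 1}} (hi : i < otp a) (hj : j < otp a)
    (h : nth a i = nth a j) : i = j := by
  rw [← (nth_spec hi).2, ← (nth_spec hj).2, h]

theorem exists_nth_eq {a : Set Ordinal.{u}} {γ : Ordinal.{u}} (hγ : γ ∈ a) :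
    ∃ i < otp a, nth a i = γ :=
  ⟨_, nth_otp_inter hγ⟩

theorem aligned_of_nth {a b : Set Ordinal.{u}} (h : otp a = otp b)
    (h' : ∀ i < otp a, ∀ j < otp b, nth a i = nth b j → i = j) : Aligned a b := by
  refine ⟨h, ?_⟩
  rintro γ ⟨ha, hb⟩
  have h1 := nth_otp_inter ha
  have h2 := nth_otp_inter hb
  exact h' _ h1.1 _ h2.1 (h1.2.trans h2.2.symm)

variable {n : ℕ} {a b : Fin n → Ordinal.{u}}

theorem otp_range (ha : StrictMono a) : otp (range a) = n := by
  have e : (Fin n) ≃o range a := ha.orderIso a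
  have := e.toRelIsoLT.ordinal_lift_type_eq
  rw [otp]
  simpa using this.symm

theorem otp_range_inter (ha : StrictMono a) (p : Fin n) :
    otp (range a ∩ Iio (a p)) = (p : ℕ) := by
  have h : range a ∩ Iio (a p) = range fun q : Fin p.1 => a (Fin.castLE p.2.le q) := by
    ext γ
    constructor
    · rintro ⟨⟨q, rfl⟩, hq⟩
      exact ⟨⟨q.1, ha.lt_iff_lt.1 hq⟩, rfl⟩
    · rintro ⟨q, rfl⟩
      exact ⟨⟨_, rfl⟩, ha (show q.1 < p.1 from q.2)⟩
  rw [h]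
  exact otp_range (a := fun q : Fin p.1 => a (Fin.castLE p.2.le q)) fun q q' hq => ha hq

theorem nth_range (ha : StrictMono a) (p : Fin n) :
    nth (range a) ((p : ℕ) : Ordinal.{u + 1}) = a p := by
  have := nth_otp_inter (a := range a) ⟨p, rfl⟩
  rw [otp_range_inter ha] at this
  exact this.2

theorem tupleAligned_of_aligned (ha : StrictMono a) (hb : StrictMono b)
    (h : Aligned (range a) (range b)) : TupleAligned a b := by
  intro p q hpq
  have := h.2 (a p) ⟨⟨p, rfl⟩, ⟨q, hpq.symm⟩⟩
  rw [otp_range_inter ha, hpq, otp_range_inter hb] at this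
  exact Fin.ext (by exact_mod_cast this)

theorem subseq_range (ha : StrictMono a) (m : ℕ) :
    subseq (range a) (Iio (n : Ordinal.{u + 1}) \ Iio (m : Ordinal.{u + 1})) =
      range fun j : Fin (n - m) => a ⟨m + j, by omega⟩ := by
  ext γ
  constructor
  · rintro ⟨o, ⟨ho, hm⟩, rfl⟩
    obtain ⟨k, rfl⟩ := Ordinal.lt_omega0.1 (lt_trans ho (Ordinal.natCast_lt_omega0 n))
    have ho' : k < n := by exact_mod_cast mem_Iio.1 ho
    have hm' : m ≤ k := by simpa using hm
    refine ⟨⟨k - m, by omega⟩, ?_⟩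
    rw [show ((k : ℕ) : Ordinal.{u + 1}) = ((⟨k, ho'⟩ : Fin n) : ℕ) from rfl, nth_range ha]
    exact congrArg a (Fin.ext (Nat.add_sub_cancel' hm'))
  · rintro ⟨j, rfl⟩
    refine ⟨((m + j : ℕ) : Ordinal.{u + 1}), ⟨?_, ?_⟩, nth_range ha ⟨m + j, by omega⟩⟩
    · have : m + j.1 < n := by omega
      exact mem_Iio.2 (by exact_mod_cast this)
    · simp

theorem eq_of_alignedAbove (ha : StrictMono a) (hb : StrictMono b) {m : ℕ}
    (h : AlignedAbove n m (range a) (range b)) (p q : Fin n) (hp : m ≤ p.1) (hq : m ≤ q.1)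
    (hpq : a p = b q) : p = q := by
  rw [AlignedAbove, subseq_range ha, subseq_range hb] at h
  have := tupleAligned_of_aligned (fun i j hij => ha (by simpa using hij))
    (fun i j hij => hb (by simpa using hij)) h ⟨p - m, by omega⟩ ⟨q - m, by omega⟩ (by
      convert hpq using 2 <;> · ext; simp; omega)
  simp only [Fin.mk.injEq] at this
  exact Fin.ext (by omega)

theorem strictMono_update_of_possible (ha : StrictMono a) (m : Fin n) {α : Ordinal.{u}}
    (h : Possible (range a) m α) : StrictMono (Function.update a m α) := by
  obtain ⟨h1, h2⟩ := h
  intro p q hpq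
  have hpq' : p.1 < q.1 := hpq
  by_cases hp : p = m
  · subst hp
    rw [Function.update_self, Function.update_of_ne hpq.ne']
    have hlt : p.1 + 1 < n := by omega
    have := h2 (by rw [otp_range ha]; exact_mod_cast hlt)
    rw [show ((p.1 + 1 : ℕ) : Ordinal.{u + 1}) = ((⟨p.1 + 1, hlt⟩ : Fin n) : ℕ) from rfl,
      nth_range ha] at this
    exact this.trans_le (ha.monotone (show p.1 + 1 ≤ q.1 from hpq'))
  · by_cases hq : q = m
    · subst hq
      rw [Function.update_self, Function.update_of_ne hpq.ne]
      have := h1 (by omega)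
      rw [show ((q.1 - 1 : ℕ) : Ordinal.{u + 1}) = ((⟨q.1 - 1, by omega⟩ : Fin n) : ℕ) from rfl,
        nth_range ha] at this
      exact (ha.monotone (show p.1 ≤ q.1 - 1 by omega)).trans_lt this
    · rw [Function.update_of_ne hp, Function.update_of_ne hq]
      exact ha hpq

theorem replaceNth_range (ha : StrictMono a) (m : Fin n) (α : Ordinal.{u}) :
    replaceNth (range a) m α = range (Function.update a m α) := by
  rw [replaceNth, nth_range ha]
  ext γ
  constructor
  · rintro (⟨⟨p, rfl⟩, hp⟩ | rfl)
    · refine ⟨p, Function.update_of_ne ?_ _ _⟩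
      rintro rfl
      exact hp rfl
    · exact ⟨m, by simp⟩
  · rintro ⟨p, rfl⟩
    by_cases hp : p = m
    · subst hp
      exact Or.inr (by simp)
    · rw [Function.update_of_ne hp]
      exact Or.inl ⟨⟨p, rfl⟩, fun h => hp (ha.injective h)⟩

theorem range_mem_cardSubsets {X : Set Ordinal.{u}} (ha : StrictMono a) (h : ∀ p, a p ∈ X) :
    range a ∈ cardSubsets X n := by
  refine ⟨by rintro _ ⟨p, rfl⟩; exact h p, ?_⟩
  have := mk_range_eq_of_injective ha.injective
  simpa using this

theorem exists_tuple_of_mem_cardSubsets {Λ : Type u} [LinearOrder Λ] {ψ : Λ → Ordinal.{u}}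
    (hψ : StrictMono ψ) {b : Set Ordinal.{u}} (hb : b ∈ cardSubsets (range ψ) n) :
    ∃ x : Fin n → Λ, StrictMono x ∧ b = range (ψ ∘ x) := by
  obtain ⟨hbψ, hbn⟩ := hb
  have hbn' : #b = (n : Cardinal.{u + 1}) := by simpa using hbn
  have hfin : b.Finite := by
    rw [← lt_aleph0_iff_set_finite, hbn']
    exact natCast_lt_aleph0
  have hpre : (ψ ⁻¹' b).Finite := hfin.preimage hψ.injective.injOn
  have himg : ψ '' (ψ ⁻¹' b) = b := image_preimage_eq_of_subset hbψ
  have hcard : hpre.toFinset.card = n := by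
    rw [← Set.ncard_eq_toFinset_card _ hpre, ← Set.ncard_image_of_injective _ hψ.injective, himg,
      Set.ncard_def, Set.encard, ENat.card, hbn']
    simp
  refine ⟨hpre.toFinset.orderEmbOfFin hcard, OrderEmbedding.strictMono _, ?_⟩
  rw [range_comp, Finset.range_orderEmbOfFin, hpre.coe_toFinset, himg]

/-- Only equality between elements of the sets matters, so they can be replaced by elements of a
type in the universe of the index types. -/
theorem exists_injOn_of_small (Y : Set Ordinal.{u}) [Small.{u} Y] :
    ∃ (X : Type u) (Ψ : Ordinal.{u} → X), InjOn Ψ Y := by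
  classical
  refine ⟨Option (Shrink.{u} Y), fun o => if h : o ∈ Y then some (equivShrink Y ⟨o, h⟩) else none,
    fun o ho o' ho' h => ?_⟩
  simp only [ho, ho', dif_pos] at h
  simpa using h

end OrderType

section ToType

/-- The ordinal below `c.ord` that corresponds to an element of the canonical well-order. -/
noncomputable def toOrdinal {o : Ordinal.{u}} (i : o.ToType) : Ordinal.{u} := i.toOrd.1

theorem strictMono_toOrdinal {o : Ordinal.{u}} : StrictMono (toOrdinal : o.ToType → Ordinal.{u}) :=
  fun _ _ h => (Ordinal.ToType.mk (o := o)).symm.strictMono h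

theorem toOrdinal_lt {o : Ordinal.{u}} (i : o.ToType) : toOrdinal i < o := i.toOrd.2

theorem exists_toOrdinal_eq {o a : Ordinal.{u}} (h : a < o) : ∃ i : o.ToType, toOrdinal i = a :=
  ⟨Ordinal.ToType.mk ⟨a, h⟩, by simp [toOrdinal]⟩

end ToType

end DeltaSys

/-! ### Translation back to sets of ordinals -/

open Cardinal Ordinal Set DeltaSys in
theorem theorem3p6 (n : ℕ) (hn : 1 ≤ n) (κ ν lam μ : Cardinal.{u})
    (hκ : Cardinal.aleph0 ≤ κ) (hν : Cardinal.aleph0 ≤ ν)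
    (hκlam : κ < lam) (hνlam : ν < lam)
    (hreg : lam.IsRegular) (hinacc : DeltaSys.LtInaccessible κ lam)
    (hμ : μ = DeltaSys.sigma lam n)
    (g : Set Ordinal.{u} → Ordinal.{u})
    (hg : ∀ b ∈ DeltaSys.cardSubsets (Set.Iio μ.ord) n, g b < ν.ord)
    (U : Set Ordinal.{u} → Set Ordinal.{u})
    (hU : ∀ b ∈ DeltaSys.cardSubsets (Set.Iio μ.ord) n,
      Cardinal.mk (U b) < Cardinal.lift.{u + 1} κ) :
    ∃ H ∈ DeltaSys.cardSubsets (Set.Iio μ.ord) lam, ∃ k < ν.ord,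
      (∀ b ∈ DeltaSys.cardSubsets H n, g b = k) ∧
      DeltaSys.IsUniformDeltaSystem n H U ∧
      (∀ a ∈ DeltaSys.cardSubsets H n, ∀ b ∈ DeltaSys.cardSubsets H n, ∀ m < n,
        DeltaSys.AlignedAbove n m a b →
        DeltaSys.nth a m = DeltaSys.nth b m →
        ∀ α ∈ H, DeltaSys.Possible a m α → DeltaSys.Possible b m α →
          DeltaSys.tpInt (U a) (U b) =
            DeltaSys.tpInt (U (DeltaSys.replaceNth a m α)) (U (DeltaSys.replaceNth b m α))) := by
  have hlam' : ℵ₀ < lam := hκ.trans_lt hκlam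
  have hνpos : ν.ord ≠ 0 := by
    rw [Ne, ord_eq_zero]
    exact (aleph0_pos.trans_le hν).ne'
  have hκpos : κ.ord ≠ 0 := by
    rw [Ne, ord_eq_zero]
    exact (aleph0_pos.trans_le hκ).ne'
  have : Nonempty ν.ord.ToType := Ordinal.nonempty_toType_iff.2 hνpos
  have : Nonempty κ.ord.ToType := Ordinal.nonempty_toType_iff.2 hκpos
  let L := μ.ord.ToType
  let φ : L → Ordinal.{u} := toOrdinal
  have hφ : StrictMono φ := strictMono_toOrdinal
  -- Order types of sets of ordinals live one universe higher, so positions below `κ.ord` are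
  -- lifted.
  let pos : κ.ord.ToType → Ordinal.{u + 1} := fun i => Ordinal.lift.{u + 1} (toOrdinal i)
  have hpos : StrictMono pos := fun i j h => Ordinal.lift_lt.2 (strictMono_toOrdinal h)
  have hB : ∀ x : Fin n → L, StrictMono x → range (φ ∘ x) ∈ cardSubsets (Iio μ.ord) n :=
    fun x hx => range_mem_cardSubsets (hφ.comp hx) fun p => toOrdinal_lt (x p)
  have hpos_surj : ∀ (k : κ.ord.ToType) (o : Ordinal.{u + 1}), o < pos k → ∃ i : Iio k, pos i = o := by
    intro k o ho
    obtain ⟨o', rfl⟩ := Ordinal.mem_range_lift_of_le ho.le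
    have h1 : o' < toOrdinal k := Ordinal.lift_lt.1 ho
    obtain ⟨i, rfl⟩ := exists_toOrdinal_eq (h1.trans (toOrdinal_lt k))
    exact ⟨⟨i, strictMono_toOrdinal.lt_iff_lt.1 h1⟩, rfl⟩
  -- The colour combines the value of `g` with the order type of the set, which is below `κ.ord`.
  -- Homogeneity thus also yields condition (i) and a common set of positions.
  have hcol : ∀ x : Fin n → L, ∃ c : ν.ord.ToType × κ.ord.ToType, StrictMono x →
      toOrdinal c.1 = g (range (φ ∘ x)) ∧ pos c.2 = otp (U (range (φ ∘ x))) := by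
    intro x
    by_cases hx : StrictMono x
    · obtain ⟨c₁, h₁⟩ := exists_toOrdinal_eq (hg _ (hB x hx))
      have h2 : otp (U (range (φ ∘ x))) < Ordinal.lift.{u + 1} κ.ord := by
        rw [lift_ord, Cardinal.lt_ord]
        exact hU _ (hB x hx)
      obtain ⟨o, ho⟩ := Ordinal.mem_range_lift_of_le h2.le
      rw [← ho, Ordinal.lift_lt] at h2
      obtain ⟨c₂, h₂⟩ := exists_toOrdinal_eq h2
      exact ⟨(c₁, c₂), fun _ => ⟨h₁, by rw [← ho, ← h₂]⟩⟩
    · exact ⟨Classical.arbitrary _, fun h => (hx h).elim⟩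
  choose col hcol using hcol
  let Y : Set Ordinal.{u} := ⋃ x : {x : Fin n → L // StrictMono x}, U (range (φ ∘ x.1))
  have hsmall : ∀ x : {x : Fin n → L // StrictMono x}, Small.{u} (U (range (φ ∘ x.1))) := by
    intro x
    rw [Cardinal.small_iff_lift_mk_lt_univ]
    have h1 := hU _ (hB x.1 x.2)
    rw [Cardinal.lift_id]
    exact h1.trans (Cardinal.lift_lt_univ κ)
  have : Small.{u} Y := small_iUnion _
  obtain ⟨X, Ψ, hΨ⟩ := exists_injOn_of_small Y
  have hY : ∀ x : Fin n → L, StrictMono x → U (range (φ ∘ x)) ⊆ Y := fun x hx =>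
    subset_iUnion (fun x : {x : Fin n → L // StrictMono x} => U (range (φ ∘ x.1))) ⟨x, hx⟩
  have hΛ := isInitial_toType_ord lam
  obtain ⟨m, rfl⟩ : ∃ m, n = m + 1 := ⟨n - 1, by omega⟩
  obtain ⟨k, h, hh, hhk, ⟨r, hr⟩, hshift⟩ := hasDeltaSystems_sigma hreg hlam' hΛ m L
    (hμ ▸ isInitial_toType_ord μ) (ν.ord.ToType × κ.ord.ToType) (fun c => Iio c.2) X col
    (fun c x i => Ψ (nth (U (range (φ ∘ x))) (pos i)))
    (by
      rw [mk_prod, Cardinal.lift_id, Cardinal.lift_id, mk_toType, mk_toType, card_ord, card_ord]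
      exact mul_lt_of_lt hreg.aleph0_le hνlam hκlam)
    (fun c θ hθ => (le_powerlt θ ((isInitial_toType_ord κ).mk_Iio_lt c.2)).trans_lt
      (hinacc.2 θ hθ))
    (by
      intro x hx i j hij
      have hlt : ∀ i : Iio (col x).2, pos i < otp (U (range (φ ∘ x))) := fun i =>
        (hcol x hx).2 ▸ hpos i.2
      exact Subtype.ext (hpos.injective (nth_injOn (hlt i) (hlt j)
        (hΨ (hY x hx (nth_spec (hlt i)).1) (hY x hx (nth_spec (hlt j)).1) hij))))
  let ψ : lam.ord.ToType → Ordinal.{u} := φ ∘ h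
  have hψ : StrictMono ψ := hφ.comp hh
  have hotp : ∀ x : Fin (m + 1) → lam.ord.ToType, StrictMono x →
      otp (U (range (ψ ∘ x))) = pos k.2 := fun x hx => by
    rw [← hhk x hx]
    exact (hcol _ (hh.comp hx)).2.symm
  have heq : ∀ x y : Fin (m + 1) → lam.ord.ToType, StrictMono x → StrictMono y →
      ∀ i j : Iio k.2, Ψ (nth (U (range (φ ∘ h ∘ x))) (pos i)) =
        Ψ (nth (U (range (φ ∘ h ∘ y))) (pos j)) ↔
      nth (U (range (ψ ∘ x))) (pos i) = nth (U (range (ψ ∘ y))) (pos j) := by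
    intro x y hx hy i j
    have hmem : ∀ z : Fin (m + 1) → lam.ord.ToType, StrictMono z → ∀ i : Iio k.2,
        nth (U (range (ψ ∘ z))) (pos i) ∈ Y := fun z hz i =>
      hY (h ∘ z) (hh.comp hz) (nth_spec ((hpos i.2).trans_eq (hotp z hz).symm)).1
    exact hΨ.eq_iff (hmem x hx i) (hmem y hy j)
  refine ⟨range ψ, ⟨by rintro _ ⟨ξ, rfl⟩; exact toOrdinal_lt (h ξ), ?_⟩, toOrdinal k.1,
    toOrdinal_lt _, ?_, ⟨pos k.2, fun s => {o | ∃ i : Iio k.2, pos i = o ∧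
      i ∈ r {p | ((p : ℕ) : Ordinal.{u + 1}) ∈ s}}, ?_, ?_, ?_, ?_⟩, ?_⟩
  · have := mk_range_eq_of_injective hψ.injective
    rw [Cardinal.lift_id'.{u, u + 1}] at this
    simpa using this
  · intro b hb
    obtain ⟨x, hx, rfl⟩ := exists_tuple_of_mem_cardSubsets hψ hb
    rw [← hhk x hx]
    exact (hcol _ (hh.comp hx)).1.symm
  · rintro s _ _ ⟨i, rfl, _⟩
    exact hpos i.2
  · intro b hb
    obtain ⟨x, hx, rfl⟩ := exists_tuple_of_mem_cardSubsets hψ hb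
    exact hotp x hx
  · intro a ha b hb s hs hab hrs
    obtain ⟨x, hx, rfl⟩ := exists_tuple_of_mem_cardSubsets hψ ha
    obtain ⟨y, hy, rfl⟩ := exists_tuple_of_mem_cardSubsets hψ hb
    have hal' := tupleAligned_of_aligned (hψ.comp hx) (hψ.comp hy) hab
    have hal : TupleAligned x y := fun p q hpq => hal' p q (congrArg ψ hpq)
    have hroot : {p : Fin (m + 1) | ((p : ℕ) : Ordinal.{u + 1}) ∈ s} = {p | x p = y p} := by
      ext p
      rw [← hrs]
      constructor
      · rintro ⟨_, q, hq⟩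
        rw [nth_range (hψ.comp hx)] at hq
        have := hal' p q hq.symm
        subst this
        exact hψ.injective hq.symm
      · intro hp
        refine ⟨by rw [otp_range (hψ.comp hx)]; exact_mod_cast p.2, ?_⟩
        rw [nth_range (hψ.comp hx)]
        exact ⟨p, congrArg ψ (Eq.symm hp)⟩
    have key : ∀ i j : Iio k.2, nth (U (range (ψ ∘ x))) (pos i) = nth (U (range (ψ ∘ y))) (pos j) ↔
        i = j ∧ i ∈ r {p | ((p : ℕ) : Ordinal.{u + 1}) ∈ s} := fun i j => by
      rw [hroot, ← heq x y hx hy]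
      exact hr.eq_iff x y hx hy hal i j
    refine ⟨aligned_of_nth ((hotp x hx).trans (hotp y hy).symm) fun o ho o' ho' hoo => ?_, ?_⟩
    · rw [hotp x hx] at ho
      rw [hotp y hy] at ho'
      obtain ⟨i, rfl⟩ := hpos_surj _ _ ho
      obtain ⟨j, rfl⟩ := hpos_surj _ _ ho'
      rw [((key i j).1 hoo).1]
    · ext o
      constructor
      · rintro ⟨ho, hoU⟩
        rw [hotp x hx] at ho
        obtain ⟨i, rfl⟩ := hpos_surj _ _ ho
        obtain ⟨o', ho', hoo⟩ := exists_nth_eq hoU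
        rw [hotp y hy] at ho'
        obtain ⟨j, rfl⟩ := hpos_surj _ _ ho'
        exact ⟨i, rfl, ((key i j).1 hoo.symm).2⟩
      · rintro ⟨i, rfl, hi⟩
        refine ⟨by rw [hotp x hx]; exact hpos i.2, ?_⟩
        rw [(key i i).2 ⟨rfl, hi⟩]
        exact (nth_spec (by rw [hotp y hy]; exact hpos i.2)).1
  · intro s _ s' _
    ext o
    have hint : {p : Fin (m + 1) | ((p : ℕ) : Ordinal.{u + 1}) ∈ s ∩ s'} =
      {p : Fin (m + 1) | ((p : ℕ) : Ordinal.{u + 1}) ∈ s} ∩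
      {p : Fin (m + 1) | ((p : ℕ) : Ordinal.{u + 1}) ∈ s'} := rfl
    constructor
    · rintro ⟨i, rfl, hi⟩
      rw [hint, hr.inter] at hi
      exact ⟨⟨i, rfl, hi.1⟩, ⟨i, rfl, hi.2⟩⟩
    · rintro ⟨⟨i, rfl, hi⟩, ⟨j, hj, hj'⟩⟩
      obtain rfl : j = i := Subtype.ext (hpos.injective hj)
      refine ⟨j, rfl, ?_⟩
      rw [hint, hr.inter]
      exact ⟨hi, hj'⟩
  · intro a ha b hb l hl hab hnth α hα hpa hpb
    obtain ⟨x, hx, rfl⟩ := exists_tuple_of_mem_cardSubsets hψ ha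
    obtain ⟨y, hy, rfl⟩ := exists_tuple_of_mem_cardSubsets hψ hb
    obtain ⟨β, rfl⟩ := hα
    let l' : Fin (m + 1) := ⟨l, hl⟩
    have hψx := hψ.comp hx
    have hψy := hψ.comp hy
    have hupd : ∀ z : Fin (m + 1) → lam.ord.ToType,
        Function.update (ψ ∘ z) l' (ψ β) = ψ ∘ Function.update z l' β := fun z =>
      (Function.comp_update ψ z l' β).symm
    have hx' : StrictMono (Function.update x l' β) := by
      have := strictMono_update_of_possible hψx l' hpa
      rw [hupd] at this
      exact fun p q hpq => hψ.lt_iff_lt.1 (this hpq)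
    have hy' : StrictMono (Function.update y l' β) := by
      have := strictMono_update_of_possible hψy l' hpb
      rw [hupd] at this
      exact fun p q hpq => hψ.lt_iff_lt.1 (this hpq)
    rw [show (l : ℕ) = (l' : ℕ) from rfl, replaceNth_range hψx, replaceNth_range hψy, hupd, hupd]
    have hxy : x l' = y l' := hψ.injective (by
      have h1 := nth_range hψx l'
      have h2 := nth_range hψy l'
      exact h1.symm.trans (hnth.trans h2))
    have key : ∀ i j : Iio k.2, nth (U (range (ψ ∘ x))) (pos i) = nth (U (range (ψ ∘ y))) (pos j) ↔
        nth (U (range (ψ ∘ Function.update x l' β))) (pos i) =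
          nth (U (range (ψ ∘ Function.update y l' β))) (pos j) := fun i j => by
      rw [← heq x y hx hy, ← heq _ _ hx' hy']
      refine hshift x y hx hy l' (fun p q hp hq hpq => ?_) hxy β hx' hy' i j
      exact eq_of_alignedAbove hψx hψy hab p q hp hq (congrArg ψ hpq)
    ext ⟨o, o'⟩
    simp only [tpInt, mem_ofPred_eq, hotp x hx, hotp y hy, hotp _ hx', hotp _ hy']
    refine and_congr_right fun ho => and_congr_right fun ho' => ?_
    obtain ⟨i, rfl⟩ := hpos_surj _ _ ho
    obtain ⟨j, rfl⟩ := hpos_surj _ _ ho'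
    exact key i j
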